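/- Let $\alpha\in(0,1)\cup(1,2)$, let $0<t_0<T_1$, let $\mu\in L^2(0,t_0)$ be real-valued with $\mu\not\equiv 0$ in $(0,t_0)$ (that is, $\mu$ is not almost everywhere zero), and let $(\lambda_n)_{n\in\mathbb N}$ be real numbers with $0<\lambda_1<\lambda_2<\cdots$. With the Mittag-Leffler function $E_{\alpha,\beta}(z)=\sum_{k=0}^\infty \frac{z^k}{\Gamma(\alpha k+\beta)}$, set $$\psi_n(t)=\int_0^{t_0}(t-s)^{\alpha-1}E_{\alpha,\alpha}\bigl(-\lambda_n(t-s)^\alpha\bigr)\,\mu(s)\,ds,\qquad t\ge T_1,\ n\in\mathbb N.$$ Suppose that the real numbers $a_n$, $n\in\mathbb N$, satisfy $\sum_{n=1}^\infty\left|\frac{a_n}{\lambda_n}\right|<\infty$, and that for each $p\in\mathbb N$ there exist constants $T_2(p)>0$ and $C(p)>0$ such that $$\left|\sum_{n=1}^\infty a_n\psi_n(t)\right|\le \frac{C(p)}{t^p}\qquad\text{for all } t\ge T_1 \text{ with } t>T_2(p).$$ Then $a_n=0$ for all $n\in\mathbb N$. -/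

import Mathlib

open Set MeasureTheory

noncomputable section

/-- The two-parameter Mittag-Leffler function
`E_{α,β}(z) = ∑_{k ≥ 0} z ^ k / Γ(α k + β)`, for `α, β > 0` and a real or complex argument. -/
def mittagLeffler {𝕜 : Type*} [RCLike 𝕜] (α β : ℝ) (z : 𝕜) : 𝕜 :=
  ∑' k : ℕ, z ^ k / ((Real.Gamma (α * k + β) : ℝ) : 𝕜)

/-- The function
`ψ(t) = ∫₀^{t₀} (t - s) ^ (α - 1) E_{α,α}(-l (t - s) ^ α) μ(s) ds`, meant for `t > t₀`
(so that `t - s > 0` on the whole range of integration). -/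
def psi (α t₀ : ℝ) (μ : ℝ → ℝ) (l t : ℝ) : ℝ :=
  ∫ s in (0 : ℝ)..t₀, (t - s) ^ (α - 1) * mittagLeffler α α (-l * (t - s) ^ α) * μ s

end

open Filter Topology

/-! ### Lower bounds for the Gamma function on vertical lines -/

/-! For `0 < α < 2` the function `E_{α,α}(-x)` has an expansion in powers `x⁻¹ ^ (k + 1)` as `x →
∞`, with coefficients `mlCoeff α k = (-1) ^ k / Γ(-α k)`. Inserted into the superposition and summed
over `n`, it gives `∑ k, mlCoeff α k * A k * P k t`, where `A k = ∑' n, a n / lam n ^ (k + 1)` and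
`P k` is the convolution of `μ` with `t ^ (-(1 + α k))`. If `m` is the index of the first nonzero
moment of `μ`, then `P k t` is asymptotic to a nonzero multiple of `t ^ (-(1 + α k + m))`. These
exponents are distinct, so rapid decay forces `mlCoeff α k * A k = 0` for every `k`
(`mlCoeff_mul_tsum_eq_zero`). As `α` is not an integer, infinitely many `mlCoeff α k` are nonzero,
and the vanishing of infinitely many `A k` gives `a = 0` (`eq_zero_of_frequently_tsum_eq_zero`).

The expansion comes from a Mellin–Barnes integral `B β` (`barnesIntegral`). Moving its line from `Re
s = 1/2` to `Re s = -1/2` crosses one pole and yields `B β + x * B (β + α) = 1 / Γ(β)`. Iterated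
towards larger `β` this produces the power series of `E_{α,β}(-x)`; iterated towards smaller `β`,
the expansion at infinity. Convergence rests on `1 / Γ` growing essentially like `exp (π |y| / 2)`
on vertical lines, against `cosh (π y)` in the denominator; this is where `α < 2` enters. -/

theorem integrable_exp_neg_mul_abs {b : ℝ} (hb : 0 < b) :
    Integrable (fun y : ℝ => Real.exp (-b * |y|)) := by
  rw [← integrableOn_univ, ← Iic_union_Ioi (a := (0 : ℝ))]
  refine IntegrableOn.union ?_ ?_
  · refine (integrableOn_exp_mul_Iic hb 0).congr_fun ?_ measurableSet_Iic
    intro y hy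
    simp only [abs_of_nonpos (mem_Iic.1 hy)]
    ring_nf
  · refine (exp_neg_integrableOn_Ioi 0 hb).congr_fun ?_ measurableSet_Ioi
    intro y hy
    simp only [abs_of_pos (mem_Ioi.1 hy)]

theorem norm_GammaSeq (z : ℂ) {n : ℕ} (hn : 0 < n) :
    ‖Complex.GammaSeq z n‖ =
      (n : ℝ) ^ z.re * n.factorial / ∏ j ∈ Finset.range (n + 1), ‖z + j‖ := by
  rw [Complex.GammaSeq, norm_div, norm_mul, norm_prod, Complex.norm_natCast_cpow_of_pos hn,
    Complex.norm_natCast]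

/-- After division this says that `√(1 + y² / (a + j)²)` decreases in `a`. It compares the factors
of Euler's product for `Γ` one by one. -/
theorem norm_add_mul_half_le {x : ℝ} (hx : 1 / 2 ≤ x) (y : ℝ) (j : ℕ) :
    ‖((x : ℂ) + y * Complex.I) + j‖ * ‖((1 / 2 : ℝ) : ℂ) + j‖ ≤
      ‖(x : ℂ) + j‖ * ‖(((1 / 2 : ℝ) : ℂ) + y * Complex.I) + j‖ := by
  have h1 (a : ℝ) : ‖((a : ℂ) + y * Complex.I) + j‖ = Real.sqrt ((a + j) ^ 2 + y ^ 2) := by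
    rw [← Complex.norm_add_mul_I]; congr 1; push_cast; ring
  have h2 (a : ℝ) (ha : 0 ≤ a) : ‖(a : ℂ) + j‖ = Real.sqrt ((a + j) ^ 2) := by
    rw [Real.sqrt_sq (by positivity)]
    have : (a : ℂ) + j = ((a + j : ℝ) : ℂ) := by push_cast; ring
    rw [this, Complex.norm_real, Real.norm_of_nonneg (by positivity)]
  rw [h1, h1, h2 x (by linarith), h2 _ (by norm_num), ← Real.sqrt_mul (by positivity),
    ← Real.sqrt_mul (by positivity)]
  apply Real.sqrt_le_sqrt
  have h3 : (1 / 2 + (j : ℝ)) ^ 2 ≤ (x + j) ^ 2 := by gcongr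
  nlinarith [mul_le_mul_of_nonneg_left h3 (sq_nonneg y)]

theorem norm_GammaSeq_mul_half_le {x : ℝ} (hx : 1 / 2 ≤ x) (y : ℝ) {n : ℕ} (hn : 0 < n) :
    ‖Complex.GammaSeq x n‖ * ‖Complex.GammaSeq (((1 / 2 : ℝ) : ℂ) + y * Complex.I) n‖ ≤
      ‖Complex.GammaSeq ((x : ℂ) + y * Complex.I) n‖ *
        ‖Complex.GammaSeq ((1 / 2 : ℝ) : ℂ) n‖ := by
  rw [norm_GammaSeq _ hn, norm_GammaSeq _ hn, norm_GammaSeq _ hn, norm_GammaSeq _ hn,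
    div_mul_div_comm, div_mul_div_comm]
  have hpos (a : ℝ) (ha : 1 / 2 ≤ a) (y : ℝ) (j : ℕ) : 0 < ‖((a : ℂ) + y * Complex.I) + j‖ := by
    rw [norm_pos_iff]
    intro h
    have := congrArg Complex.re h
    simp at this
    have : (0 : ℝ) ≤ j := by positivity
    linarith
  have hpos' (a : ℝ) (ha : 1 / 2 ≤ a) (j : ℕ) : 0 < ‖(a : ℂ) + j‖ := by
    simpa using hpos a ha 0 j
  simp only [Complex.add_re, Complex.ofReal_re, Complex.mul_re, Complex.I_re, Complex.I_im,
    Complex.ofReal_im, mul_zero, zero_mul, sub_zero, add_zero]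
  refine div_le_div_of_nonneg_left (by positivity) ?_ ?_
  · exact mul_pos (Finset.prod_pos fun j _ => hpos x hx y j)
      (Finset.prod_pos fun j _ => hpos' _ le_rfl j)
  · rw [← Finset.prod_mul_distrib, ← Finset.prod_mul_distrib]
    exact Finset.prod_le_prod (fun j _ => by positivity) fun j _ => norm_add_mul_half_le hx y j

theorem norm_Gamma_mul_half_le {x : ℝ} (hx : 1 / 2 ≤ x) (y : ℝ) :
    ‖Complex.Gamma x‖ * ‖Complex.Gamma (((1 / 2 : ℝ) : ℂ) + y * Complex.I)‖ ≤
      ‖Complex.Gamma ((x : ℂ) + y * Complex.I)‖ * ‖Complex.Gamma ((1 / 2 : ℝ) : ℂ)‖ := by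
  refine le_of_tendsto_of_tendsto
    (((Complex.GammaSeq_tendsto_Gamma _).norm).mul (Complex.GammaSeq_tendsto_Gamma _).norm)
    (((Complex.GammaSeq_tendsto_Gamma _).norm).mul (Complex.GammaSeq_tendsto_Gamma _).norm) ?_
  filter_upwards [eventually_gt_atTop 0] with n hn using norm_GammaSeq_mul_half_le hx y hn

/-- On the line `Re z = 1/2` one has `1 - z = conj z`, so the reflection formula evaluates `|Γ(z)|²`
exactly. -/
theorem norm_Gamma_half_add_mul_I_sq (y : ℝ) :
    ‖Complex.Gamma (((1 / 2 : ℝ) : ℂ) + y * Complex.I)‖ ^ 2 * Real.cosh (Real.pi * y) =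
      Real.pi := by
  have h := Complex.Gamma_mul_Gamma_one_sub (((1 / 2 : ℝ) : ℂ) + y * Complex.I)
  have h1 : 1 - ((((1 / 2 : ℝ) : ℂ)) + y * Complex.I) =
      (starRingEnd ℂ) (((1 / 2 : ℝ) : ℂ) + y * Complex.I) := by
    simp only [map_add, map_mul, Complex.conj_ofReal, Complex.conj_I]; push_cast; ring
  have h2 : Complex.sin (Real.pi * (((1 / 2 : ℝ) : ℂ) + y * Complex.I)) =
      ((Real.cosh (Real.pi * y) : ℝ) : ℂ) := by
    have : (Real.pi : ℂ) * (((1 / 2 : ℝ) : ℂ) + y * Complex.I) =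
        (Real.pi * y : ℂ) * Complex.I + Real.pi / 2 := by push_cast; ring
    rw [this, Complex.sin_add_pi_div_two, Complex.cos_mul_I]; push_cast; rfl
  rw [h1, Complex.Gamma_conj, Complex.mul_conj, h2, Complex.normSq_eq_norm_sq] at h
  have hc := Real.cosh_pos (Real.pi * y)
  have h3 : ‖Complex.Gamma (((1 / 2 : ℝ) : ℂ) + y * Complex.I)‖ ^ 2 =
      Real.pi / Real.cosh (Real.pi * y) := by exact_mod_cast h
  rw [h3]; field_simp

/-- The ratio `|Γ(x + iy)| / Γ(x)` is at least its value at `x = 1/2`, which is `cosh (π y) ^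
(-1/2)`. The dependence on `x` is kept explicit because `x` tends to infinity in the remainder of
the power series. -/
theorem norm_Gamma_inv_le {x : ℝ} (hx : 1 / 2 ≤ x) (y : ℝ) :
    ‖(Complex.Gamma ((x : ℂ) + y * Complex.I))⁻¹‖ ≤
      (Real.Gamma x)⁻¹ * Real.exp (Real.pi / 2 * |y|) := by
  have h := norm_Gamma_mul_half_le hx y
  have hG : 0 < Real.Gamma x := Real.Gamma_pos_of_pos (by linarith)
  rw [Complex.Gamma_ofReal, Complex.Gamma_ofReal, Complex.norm_real, Complex.norm_real,
    Real.norm_of_nonneg hG.le, Real.norm_of_nonneg (Real.Gamma_pos_of_pos (by norm_num)).le,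
    Real.Gamma_one_half_eq] at h
  have h2 := norm_Gamma_half_add_mul_I_sq y
  set u := ‖Complex.Gamma (((1 / 2 : ℝ) : ℂ) + y * Complex.I)‖
  set v := ‖Complex.Gamma ((x : ℂ) + y * Complex.I)‖ with hv
  have hcosh : Real.cosh (Real.pi * y) ≤ Real.exp (Real.pi / 2 * |y|) ^ 2 := by
    rw [← Real.exp_nat_mul, ← Real.cosh_abs, abs_mul, abs_of_pos Real.pi_pos, Real.cosh_eq]
    have : Real.exp (-(Real.pi * |y|)) ≤ Real.exp (Real.pi * |y|) := by
      apply Real.exp_le_exp.2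
      have : 0 ≤ Real.pi * |y| := by positivity
      linarith
    have e : ((2 : ℕ) : ℝ) * (Real.pi / 2 * |y|) = Real.pi * |y| := by push_cast; ring
    rw [e]; linarith
  set w := Real.exp (Real.pi / 2 * |y|) with hw
  have hwpos : 0 < w := Real.exp_pos _
  have hu : Real.sqrt Real.pi ≤ u * w := by
    apply Real.sqrt_le_iff.2 ⟨by positivity, ?_⟩
    calc Real.pi = u ^ 2 * Real.cosh (Real.pi * y) := h2.symm
      _ ≤ u ^ 2 * w ^ 2 := by gcongr
      _ = _ := by ring
  have hs : 0 < Real.sqrt Real.pi := Real.sqrt_pos.2 Real.pi_pos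
  have hup : 0 < u := by
    rcases (norm_nonneg (Complex.Gamma (((1 / 2 : ℝ) : ℂ) + y * Complex.I))).eq_or_lt with h0 | h0
    · exact absurd hu (by change ¬ _ ≤ ‖_‖ * w; rw [← h0]; simpa using hs)
    · exact h0
  have hvp : 0 < v := by
    by_contra hcon
    have h0 : v = 0 := le_antisymm (not_lt.1 hcon) (norm_nonneg _)
    rw [h0] at h
    nlinarith [mul_pos hG hup]
  rw [norm_inv, ← hv, inv_mul_eq_div, inv_le_comm₀ hvp (by positivity), inv_div]
  rw [div_le_iff₀ hwpos]
  have : Real.Gamma x * u * w ≤ v * w * (u * w) := by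
    calc Real.Gamma x * u * w ≤ v * Real.sqrt Real.pi * w := by gcongr
      _ = v * w * Real.sqrt Real.pi := by ring
      _ ≤ v * w * (u * w) := by gcongr
  nlinarith [mul_pos hup hwpos]

/-- Each unit step to the left uses `1 / Γ(z) = z / Γ(z + 1)`; the linear factor `z` is absorbed by
an arbitrarily small increase of the exponential rate. -/
theorem exists_norm_Gamma_inv_le {ε : ℝ} (hε : 0 < ε) (m : ℕ) (b : ℝ) :
    ∃ C : ℝ, 0 ≤ C ∧ ∀ z : ℂ, 1 / 2 - m ≤ z.re → z.re ≤ b →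
      ‖(Complex.Gamma z)⁻¹‖ ≤ C * Real.exp ((Real.pi / 2 + ε) * |z.im|) := by
  induction m generalizing b ε with
  | zero =>
    have hcont : ContinuousOn (fun x : ℝ => (Real.Gamma x)⁻¹) (Icc (1 / 2) b) := by
      intro x hx
      have hx0 : 0 < x := by linarith [hx.1]
      refine ((Real.differentiableAt_Gamma fun n => ?_).continuousAt.inv₀
        (Real.Gamma_pos_of_pos hx0).ne').continuousWithinAt
      have : (0 : ℝ) ≤ n := by positivity
      linarith
    obtain ⟨C, hC⟩ := isCompact_Icc.exists_bound_of_continuousOn hcont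
    refine ⟨max C 0, le_max_right _ _, fun z h1 h2 => ?_⟩
    have h1' : 1 / 2 ≤ z.re := by simpa using h1
    have := norm_Gamma_inv_le h1' z.im
    rw [Complex.re_add_im] at this
    refine this.trans (mul_le_mul ?_ ?_ (Real.exp_pos _).le (le_max_right _ _))
    · exact ((le_abs_self _).trans (hC _ ⟨h1', h2⟩)).trans (le_max_left _ _)
    · apply Real.exp_le_exp.2
      gcongr
      linarith
  | succ m ih =>
    -- Half of `ε` goes to the induction hypothesis, the other half absorbs `‖z‖`.
    obtain ⟨C, hC0, hC⟩ := ih (half_pos hε) (b + 1)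
    set K := (m : ℝ) + 1 + |b| with hK
    have hK0 : 0 ≤ K := by positivity
    refine ⟨(K + 2 / ε) * C, by positivity, fun z h1 h2 => ?_⟩
    push_cast at h1
    have h := hC (z + 1) (by simp; linarith) (by simp; linarith)
    rw [Complex.one_div_Gamma_eq_self_mul_one_div_Gamma_add_one, norm_mul]
    have him : (z + 1).im = z.im := by simp
    rw [him] at h
    have hre : |z.re| ≤ K := by
      rw [abs_le]; constructor
      · have := abs_nonneg b; linarith
      · have := le_abs_self b
        have : (0 : ℝ) ≤ m := by positivity
        linarith
    have hz : ‖z‖ ≤ (K + 2 / ε) * Real.exp (ε / 2 * |z.im|) := by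
      have e1 : ε / 2 * |z.im| ≤ Real.exp (ε / 2 * |z.im|) := by
        linarith [Real.add_one_le_exp (ε / 2 * |z.im|)]
      have e2 : 1 ≤ Real.exp (ε / 2 * |z.im|) := Real.one_le_exp (by positivity)
      have e3 : |z.im| ≤ 2 / ε * Real.exp (ε / 2 * |z.im|) := by
        calc |z.im| = 2 / ε * (ε / 2 * |z.im|) := by field_simp
          _ ≤ _ := by gcongr
      calc ‖z‖ ≤ |z.re| + |z.im| := Complex.norm_le_abs_re_add_abs_im z
        _ ≤ K * Real.exp (ε / 2 * |z.im|) + 2 / ε * Real.exp (ε / 2 * |z.im|) := by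
            refine add_le_add ?_ e3
            exact hre.trans (le_mul_of_one_le_right hK0 e2)
        _ = _ := by ring
    calc ‖z‖ * ‖(Complex.Gamma (z + 1))⁻¹‖
        ≤ ((K + 2 / ε) * Real.exp (ε / 2 * |z.im|)) *
          (C * Real.exp ((Real.pi / 2 + ε / 2) * |z.im|)) := by gcongr
      _ = (K + 2 / ε) * C * (Real.exp (ε / 2 * |z.im|) *
          Real.exp ((Real.pi / 2 + ε / 2) * |z.im|)) := by ring
      _ = _ := by rw [← Real.exp_add]; congr 2; ring

/-! ### The Poisson formula at the centre of a strip -/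

theorem inv_cosh_le (y : ℝ) : (Real.cosh y)⁻¹ ≤ 2 * Real.exp (-|y|) := by
  rw [← Real.cosh_abs, Real.cosh_eq, inv_div, Real.exp_neg |y|, ← div_eq_mul_inv]
  have := Real.exp_pos (|y|)
  gcongr
  linarith [inv_pos.2 this]

theorem integrable_inv_cosh : Integrable fun y : ℝ => (Real.cosh (Real.pi * y))⁻¹ := by
  have hint := (integrable_exp_neg_mul_abs Real.pi_pos).const_mul 2
  refine hint.mono' ?_ (ae_of_all _ fun y => ?_)
  · refine Continuous.aestronglyMeasurable ?_
    exact (Real.continuous_cosh.comp (continuous_const.mul continuous_id)).inv₀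
      fun y => (Real.cosh_pos _).ne'
  · rw [Real.norm_of_nonneg (inv_nonneg.2 (Real.cosh_pos _).le)]
    refine (inv_cosh_le _).trans_eq ?_
    rw [abs_mul, abs_of_pos Real.pi_pos, neg_mul]

theorem integral_inv_cosh : ∫ y : ℝ, (Real.cosh (Real.pi * y))⁻¹ = 1 := by
  have hpi := Real.pi_pos
  have hd (y : ℝ) : HasDerivAt (fun y => 2 / Real.pi * Real.arctan (Real.exp (Real.pi * y)))
      (Real.cosh (Real.pi * y))⁻¹ y := by
    have h1 : HasDerivAt (fun y : ℝ => Real.exp (Real.pi * y))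
        (Real.exp (Real.pi * y) * (Real.pi * 1)) y :=
      ((hasDerivAt_id y).const_mul Real.pi).exp
    have h2 := (h1.arctan).const_mul (2 / Real.pi)
    refine h2.congr_deriv ?_
    rw [Real.cosh_eq, Real.exp_neg]
    have := Real.exp_pos (Real.pi * y)
    field_simp
    ring
  have ht : Tendsto (fun y : ℝ => Real.pi * y) atTop atTop := tendsto_id.const_mul_atTop hpi
  have hb : Tendsto (fun y : ℝ => Real.pi * y) atBot atBot := tendsto_id.const_mul_atBot hpi
  rw [integral_of_hasDerivAt_of_tendsto (m := 2 / Real.pi * Real.arctan 0)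
    (n := 2 / Real.pi * (Real.pi / 2)) hd integrable_inv_cosh]
  · simp
  · exact (((Real.continuous_arctan.tendsto 0).comp
      (Real.tendsto_exp_atBot.comp hb))).const_mul _
  · exact ((Real.tendsto_arctan_atTop.mono_right nhdsWithin_le_nhds).comp
      (Real.tendsto_exp_atTop.comp ht)).const_mul _

theorem sin_pi_mul_half_add (y : ℝ) :
    Complex.sin (Real.pi * (((1 / 2 : ℝ) : ℂ) + y * Complex.I)) =
      ((Real.cosh (Real.pi * y) : ℝ) : ℂ) := by
  have : (Real.pi : ℂ) * (((1 / 2 : ℝ) : ℂ) + y * Complex.I) =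
      (Real.pi * y : ℂ) * Complex.I + Real.pi / 2 := by push_cast; ring
  rw [this, Complex.sin_add_pi_div_two, Complex.cos_mul_I]; push_cast; rfl

theorem sin_pi_mul_neg_half_add (y : ℝ) :
    Complex.sin (Real.pi * (((-(1 / 2) : ℝ) : ℂ) + y * Complex.I)) =
      -((Real.cosh (Real.pi * y) : ℝ) : ℂ) := by
  have : (Real.pi : ℂ) * (((-(1 / 2) : ℝ) : ℂ) + y * Complex.I) =
      (Real.pi * y : ℂ) * Complex.I - Real.pi / 2 := by push_cast; ring
  rw [this, Complex.sin_sub_pi_div_two, Complex.cos_mul_I]; push_cast; rfl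

theorem abs_sinh_le_norm_sin (z : ℂ) : |Real.sinh z.im| ≤ ‖Complex.sin z‖ := by
  have h : Complex.sin z = ((Real.sin z.re * Real.cosh z.im : ℝ) : ℂ) +
      ((Real.cos z.re * Real.sinh z.im : ℝ) : ℂ) * Complex.I := by
    rw [Complex.sin_eq]; push_cast; ring
  rw [h, Complex.norm_add_mul_I, ← Real.sqrt_sq_eq_abs]
  apply Real.sqrt_le_sqrt
  have h1 := Real.cosh_sq z.im
  have h2 := Real.sin_sq_add_cos_sq z.re
  have : (Real.sin z.re * Real.cosh z.im) ^ 2 + (Real.cos z.re * Real.sinh z.im) ^ 2 =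
      Real.sinh z.im ^ 2 + Real.sin z.re ^ 2 := by
    calc _ = Real.sin z.re ^ 2 * Real.cosh z.im ^ 2 + Real.cos z.re ^ 2 * Real.sinh z.im ^ 2 := by
          ring
      _ = (Real.sin z.re ^ 2 + Real.cos z.re ^ 2) * Real.sinh z.im ^ 2 + Real.sin z.re ^ 2 := by
          rw [h1]; ring
      _ = _ := by rw [h2]; ring
  rw [this]
  nlinarith [sq_nonneg (Real.sin z.re)]

theorem sin_pi_mul_ne_zero_of_abs_re_le {z : ℂ} (h1 : |z.re| ≤ 1 / 2) (h0 : z ≠ 0) :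
    Complex.sin (Real.pi * z) ≠ 0 := by
  intro h
  obtain ⟨k, hk⟩ := Complex.sin_eq_zero_iff.1 h
  have hpi : (Real.pi : ℂ) ≠ 0 := by exact_mod_cast Real.pi_ne_zero
  have hz : z = k := by
    apply mul_left_cancel₀ hpi
    rw [hk]; ring
  rw [hz, Complex.intCast_re] at h1
  have hk1 : |k| < 1 := by
    have : |(k : ℝ)| < 1 := by linarith
    exact_mod_cast this
  rw [Int.abs_lt_one_iff] at hk1
  exact h0 (by rw [hz, hk1]; simp)

/-- The quotient `(h s - h 0) / sin (π s)` extended across its removable singularity at `0`. -/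
noncomputable def sinQuotient (h : ℂ → ℂ) (s : ℂ) : ℂ :=
  dslope h 0 s / dslope (fun s : ℂ => Complex.sin (Real.pi * s)) 0 s

theorem sinQuotient_of_ne (h : ℂ → ℂ) {s : ℂ} (hs : s ≠ 0) :
    sinQuotient h s = (h s - h 0) / Complex.sin (Real.pi * s) := by
  rw [sinQuotient, dslope_of_ne _ hs, dslope_of_ne _ hs, slope_def_field, slope_def_field]
  have : s - 0 ≠ 0 := by simpa using hs
  rw [div_div_div_cancel_right₀ this]
  simp

theorem differentiableOn_sinQuotient {h : ℂ → ℂ} (hh : Differentiable ℂ h) :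
    DifferentiableOn ℂ (sinQuotient h) {s | |s.re| ≤ 1 / 2} := by
  have hsin : Differentiable ℂ fun s : ℂ => Complex.sin (Real.pi * s) :=
    Complex.differentiable_sin.comp (differentiable_id.const_mul _)
  have hD (f : ℂ → ℂ) (hf : Differentiable ℂ f) : DifferentiableOn ℂ (dslope f 0) univ :=
    (Complex.differentiableOn_dslope univ_mem).2 hf.differentiableOn
  refine DifferentiableOn.div ((hD h hh).mono (subset_univ _))
    ((hD _ hsin).mono (subset_univ _)) fun s hs => ?_
  by_cases h0 : s = 0
  · subst h0
    rw [dslope_same]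
    have : HasDerivAt (fun s : ℂ => Complex.sin (Real.pi * s))
        (Complex.cos (Real.pi * 0) * (Real.pi * 1)) 0 :=
      ((hasDerivAt_id (0 : ℂ)).const_mul _).csin
    rw [this.deriv]
    simp [Real.pi_ne_zero]
  · rw [dslope_of_ne _ h0, slope_def_field]
    have := sin_pi_mul_ne_zero_of_abs_re_le hs h0
    simpa [h0] using this

theorem tendsto_exp_div_sinh {θ : ℝ} (hθ : θ < Real.pi) :
    Tendsto (fun T : ℝ => Real.exp (θ * T) / Real.sinh (Real.pi * T)) atTop (𝓝 0) := by
  have hpi := Real.pi_pos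
  have h1 : Tendsto (fun T : ℝ => 4 * Real.exp (-((Real.pi - θ) * T))) atTop (𝓝 (4 * 0)) :=
    (Real.tendsto_exp_neg_atTop_nhds_zero.comp
      (tendsto_id.const_mul_atTop (sub_pos.2 hθ))).const_mul 4
  rw [mul_zero] at h1
  refine squeeze_zero' ?_ ?_ h1
  · filter_upwards [eventually_gt_atTop 0] with T hT
    have := Real.sinh_pos_iff.2 (mul_pos hpi hT)
    positivity
  · filter_upwards [eventually_ge_atTop 1] with T hT
    have hX : 1 ≤ Real.pi * T := by nlinarith [Real.pi_gt_three]
    have hs : Real.exp (Real.pi * T) / 4 ≤ Real.sinh (Real.pi * T) := by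
      rw [Real.sinh_eq]
      have e1 : Real.exp (-(Real.pi * T)) ≤ 1 := Real.exp_le_one_iff.2 (by linarith)
      have e2 := Real.add_one_le_exp (Real.pi * T)
      linarith
    calc Real.exp (θ * T) / Real.sinh (Real.pi * T)
        ≤ Real.exp (θ * T) / (Real.exp (Real.pi * T) / 4) := by gcongr
      _ = 4 * (Real.exp (θ * T) / Real.exp (Real.pi * T)) := by field_simp
      _ = _ := by rw [← Real.exp_sub]; congr 2; ring

theorem norm_integral_sinQuotient_le {h : ℂ → ℂ} {C θ : ℝ}
    (hb : ∀ s : ℂ, |s.re| ≤ 1 / 2 → ‖h s‖ ≤ C * Real.exp (θ * |s.im|))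
    {T : ℝ} (hT : T ≠ 0) :
    ‖∫ x in (-(1 / 2) : ℝ)..(1 / 2), sinQuotient h ((x : ℂ) + (T : ℂ) * Complex.I)‖ ≤
      C * (Real.exp (θ * |T|) / Real.sinh (Real.pi * |T|)) +
        ‖h 0‖ * (Real.exp (0 * |T|) / Real.sinh (Real.pi * |T|)) := by
  have hpi := Real.pi_pos
  have hsh : 0 < Real.sinh (Real.pi * |T|) :=
    Real.sinh_pos_iff.2 (mul_pos hpi (abs_pos.2 hT))
  have key := intervalIntegral.norm_integral_le_of_norm_le_const
    (a := (-(1 / 2) : ℝ)) (b := 1 / 2)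
    (f := fun x : ℝ => sinQuotient h ((x : ℂ) + (T : ℂ) * Complex.I))
    (C := C * (Real.exp (θ * |T|) / Real.sinh (Real.pi * |T|)) +
        ‖h 0‖ * (Real.exp (0 * |T|) / Real.sinh (Real.pi * |T|))) ?_
  · refine key.trans_eq ?_
    norm_num
  · intro x hx
    rw [uIoc_of_le (by norm_num)] at hx
    set s : ℂ := (x : ℂ) + (T : ℂ) * Complex.I with hs
    have hre : s.re = x := by simp [hs]
    have him : s.im = T := by simp [hs]
    have hs0 : s ≠ 0 := fun h => hT (by rw [← him, h]; simp)
    rw [sinQuotient_of_ne h hs0, norm_div]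
    have h1 : ‖h s‖ ≤ C * Real.exp (θ * |T|) := by
      rw [← him]; exact hb s (by rw [hre, abs_le]; constructor <;> linarith [hx.1, hx.2])
    have h2 : Real.sinh (Real.pi * |T|) ≤ ‖Complex.sin (Real.pi * s)‖ := by
      refine le_trans (le_of_eq ?_) (abs_sinh_le_norm_sin _)
      rw [Complex.im_ofReal_mul, him, Real.abs_sinh, abs_mul, abs_of_pos hpi]
    calc ‖h s - h 0‖ / ‖Complex.sin (Real.pi * s)‖
        ≤ (C * Real.exp (θ * |T|) + ‖h 0‖) / Real.sinh (Real.pi * |T|) := by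
          have h3 : ‖h s - h 0‖ ≤ C * Real.exp (θ * |T|) + ‖h 0‖ :=
            (norm_sub_le _ _).trans (by gcongr)
          have h4 := (norm_nonneg _).trans h3
          gcongr
      _ = _ := by rw [zero_mul, Real.exp_zero]; ring

theorem integrable_div_cosh {g : ℝ → ℂ} (hg : Continuous g) {C θ : ℝ} (hθ : θ < Real.pi)
    (hb : ∀ y : ℝ, ‖g y‖ ≤ C * Real.exp (θ * |y|)) :
    Integrable fun y : ℝ => g y / ((Real.cosh (Real.pi * y) : ℝ) : ℂ) := by
  have hint := (integrable_exp_neg_mul_abs (sub_pos.2 hθ)).const_mul (C * 2)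
  refine hint.mono' ?_ (ae_of_all _ fun y => ?_)
  · refine Continuous.aestronglyMeasurable (hg.div ?_ fun y => ?_)
    · exact Complex.continuous_ofReal.comp
        (Real.continuous_cosh.comp (continuous_const.mul continuous_id))
    · exact_mod_cast (Real.cosh_pos _).ne'
  · have hc := Real.cosh_pos (Real.pi * y)
    have h2 := inv_cosh_le (Real.pi * y)
    rw [abs_mul, abs_of_pos Real.pi_pos] at h2
    rw [norm_div, Complex.norm_real, Real.norm_of_nonneg hc.le, div_eq_mul_inv]
    have h0 := (norm_nonneg _).trans (hb y)
    calc ‖g y‖ * (Real.cosh (Real.pi * y))⁻¹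
        ≤ (C * Real.exp (θ * |y|)) * (2 * Real.exp (-(Real.pi * |y|))) := by
          gcongr
          exact hb y
      _ = C * 2 * (Real.exp (θ * |y|) * Real.exp (-(Real.pi * |y|))) := by ring
      _ = _ := by rw [← Real.exp_add]; congr 2; ring

theorem continuous_ofReal_add_mul_I (a : ℝ) :
    Continuous fun y : ℝ => (a : ℂ) + (y : ℂ) * Complex.I :=
  continuous_const.add (Complex.continuous_ofReal.mul continuous_const)

/-- The value at the centre of a strip of a function of exponential type less than `π`, as a
weighted average over the two boundary lines. -/
theorem integral_strip_div_cosh {h : ℂ → ℂ} (hh : Differentiable ℂ h) {C θ : ℝ}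
    (hθ : θ < Real.pi)
    (hb : ∀ s : ℂ, |s.re| ≤ 1 / 2 → ‖h s‖ ≤ C * Real.exp (θ * |s.im|)) :
    (∫ y : ℝ, h (((1 / 2 : ℝ) : ℂ) + (y : ℂ) * Complex.I) /
        ((Real.cosh (Real.pi * y) : ℝ) : ℂ)) +
      (∫ y : ℝ, h (((-(1 / 2) : ℝ) : ℂ) + (y : ℂ) * Complex.I) /
        ((Real.cosh (Real.pi * y) : ℝ) : ℂ)) = 2 * h 0 := by
  have hline (a : ℝ) (ha : |a| ≤ 1 / 2) :
      Integrable fun y : ℝ => h ((a : ℂ) + (y : ℂ) * Complex.I) /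
        ((Real.cosh (Real.pi * y) : ℝ) : ℂ) := by
    refine integrable_div_cosh (hh.continuous.comp (continuous_ofReal_add_mul_I a)) hθ
      (C := C) fun y => ?_
    simpa using hb ((a : ℂ) + (y : ℂ) * Complex.I) (by simpa using ha)
  have hconst : Integrable fun y : ℝ => h 0 * (((Real.cosh (Real.pi * y))⁻¹ : ℝ) : ℂ) :=
    (integrable_inv_cosh.ofReal).const_mul _
  have hI : ∫ y : ℝ, h 0 * (((Real.cosh (Real.pi * y))⁻¹ : ℝ) : ℂ) = h 0 := by
    rw [integral_const_mul, integral_complex_ofReal, integral_inv_cosh]; simp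
  -- Subtracting `h 0` removes the pole, so Cauchy's theorem on rectangles suffices. The constant
  -- contributes `h 0` on each line because `1 / cosh (π y)` has integral `1`. Since `sin (π s)` is
  -- `cosh` on the right line and `-cosh` on the left one, equality of the two integrals of `F`
  -- becomes a formula for a sum.
  set F := sinQuotient h with hF
  have hright (y : ℝ) : F (((1 / 2 : ℝ) : ℂ) + (y : ℂ) * Complex.I) =
      h (((1 / 2 : ℝ) : ℂ) + (y : ℂ) * Complex.I) / ((Real.cosh (Real.pi * y) : ℝ) : ℂ) -
        h 0 * (((Real.cosh (Real.pi * y))⁻¹ : ℝ) : ℂ) := by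
    rw [hF, sinQuotient_of_ne, sin_pi_mul_half_add, sub_div, Complex.ofReal_inv]
    · rfl
    · intro h0
      have := congrArg Complex.re h0
      norm_num at this
  have hleft (y : ℝ) : F (((-(1 / 2) : ℝ) : ℂ) + (y : ℂ) * Complex.I) =
      -(h (((-(1 / 2) : ℝ) : ℂ) + (y : ℂ) * Complex.I) / ((Real.cosh (Real.pi * y) : ℝ) : ℂ) -
        h 0 * (((Real.cosh (Real.pi * y))⁻¹ : ℝ) : ℂ)) := by
    rw [hF, sinQuotient_of_ne, sin_pi_mul_neg_half_add, div_neg, sub_div, Complex.ofReal_inv]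
    · rfl
    · intro h0
      have := congrArg Complex.re h0
      norm_num at this
  have hrint : Integrable fun y : ℝ => F (((1 / 2 : ℝ) : ℂ) + (y : ℂ) * Complex.I) := by
    simp_rw [hright]
    exact (hline _ (by norm_num [abs_of_pos])).sub hconst
  have hlint : Integrable fun y : ℝ => F (((-(1 / 2) : ℝ) : ℂ) + (y : ℂ) * Complex.I) := by
    simp_rw [hleft]
    exact ((hline _ (by norm_num [abs_of_pos])).sub hconst).neg
  have hrect (T : ℝ) :
      (((∫ x in (-(1 / 2) : ℝ)..(1 / 2), F ((x : ℂ) + ((-T : ℝ) : ℂ) * Complex.I)) -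
        ∫ x in (-(1 / 2) : ℝ)..(1 / 2), F ((x : ℂ) + (T : ℂ) * Complex.I)) +
        Complex.I * ∫ y in (-T)..T, F (((1 / 2 : ℝ) : ℂ) + (y : ℂ) * Complex.I)) -
        Complex.I * ∫ y in (-T)..T, F (((-(1 / 2) : ℝ) : ℂ) + (y : ℂ) * Complex.I) = 0 := by
    have := Complex.integral_boundary_rect_eq_zero_of_differentiableOn F
      ⟨-(1 / 2), -T⟩ ⟨1 / 2, T⟩ ((differentiableOn_sinQuotient hh).mono ?_)
    · simpa only [smul_eq_mul] using this
    · intro s hs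
      have := hs.1
      simp only [mem_preimage, uIcc_of_le (by norm_num : (-(1 / 2) : ℝ) ≤ 1 / 2)] at this
      exact abs_le.2 this
  have hE : Tendsto (fun T : ℝ => C * (Real.exp (θ * |T|) / Real.sinh (Real.pi * |T|)) +
      ‖h 0‖ * (Real.exp (0 * |T|) / Real.sinh (Real.pi * |T|))) atTop (𝓝 0) := by
    have h1 := ((tendsto_exp_div_sinh hθ).const_mul C).add
      ((tendsto_exp_div_sinh Real.pi_pos).const_mul ‖h 0‖)
    simp only [mul_zero, add_zero] at h1
    refine h1.congr' ?_
    filter_upwards [eventually_ge_atTop 0] with T hT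
    rw [abs_of_nonneg hT]
  have htop : Tendsto (fun T : ℝ =>
      ∫ x in (-(1 / 2) : ℝ)..(1 / 2), F ((x : ℂ) + (T : ℂ) * Complex.I)) atTop (𝓝 0) := by
    refine squeeze_zero_norm' ?_ hE
    filter_upwards [eventually_gt_atTop 0] with T hT
      using norm_integral_sinQuotient_le hb hT.ne'
  have hbot : Tendsto (fun T : ℝ =>
      ∫ x in (-(1 / 2) : ℝ)..(1 / 2), F ((x : ℂ) + ((-T : ℝ) : ℂ) * Complex.I))
      atTop (𝓝 0) := by
    refine squeeze_zero_norm' ?_ hE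
    filter_upwards [eventually_gt_atTop 0] with T hT
    simpa only [abs_neg] using norm_integral_sinQuotient_le hb (neg_ne_zero.2 hT.ne')
  have hR := intervalIntegral_tendsto_integral hrint tendsto_neg_atTop_atBot tendsto_id
  have hL := intervalIntegral_tendsto_integral hlint tendsto_neg_atTop_atBot tendsto_id
  have hlim := ((hbot.sub htop).add (hR.const_mul Complex.I)).sub (hL.const_mul Complex.I)
  have hzero := tendsto_nhds_unique hlim
    ((tendsto_const_nhds (x := (0 : ℂ))).congr fun T => (hrect T).symm)
  have heq : (∫ y : ℝ, F (((1 / 2 : ℝ) : ℂ) + (y : ℂ) * Complex.I)) =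
      ∫ y : ℝ, F (((-(1 / 2) : ℝ) : ℂ) + (y : ℂ) * Complex.I) := by
    apply mul_left_cancel₀ Complex.I_ne_zero
    linear_combination hzero
  simp_rw [hright, hleft] at heq
  rw [integral_neg, integral_sub (hline _ (by norm_num [abs_of_pos])) hconst,
    integral_sub (hline _ (by norm_num [abs_of_pos])) hconst, hI] at heq
  linear_combination heq

/-! ### The Mellin–Barnes integral of the Mittag-Leffler function -/

/-- The function `x ^ (-s) / Γ(β - α s)`. -/
noncomputable def barnesKernel (α β x : ℝ) (s : ℂ) : ℂ :=
  Complex.exp (-(Real.log x) * s) * (Complex.Gamma (β - α * s))⁻¹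

/-- The Mellin–Barnes integral of `π / sin (π s) * x ^ (-s) / Γ(β - α s)` over `Re s = 1 / 2`,
divided by `2 π i`. -/
noncomputable def barnesIntegral (α β x : ℝ) : ℂ :=
  1 / 2 * ∫ y : ℝ, barnesKernel α β x (((1 / 2 : ℝ) : ℂ) + (y : ℂ) * Complex.I) /
    ((Real.cosh (Real.pi * y) : ℝ) : ℂ)

/-- The value `0` given to `Γ` at its poles makes `Γ⁻¹` the entire reciprocal, so no `β` is
exceptional. -/
theorem differentiable_barnesKernel (α β x : ℝ) : Differentiable ℂ (barnesKernel α β x) := by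
  have h1 : Differentiable ℂ fun s : ℂ => Complex.exp (-(Real.log x) * s) :=
    (differentiable_id.const_mul _).cexp
  have h2 : Differentiable ℂ fun s : ℂ => (β : ℂ) - α * s :=
    (differentiable_id.const_mul _).const_sub _
  exact h1.mul (Complex.differentiable_one_div_Gamma.comp h2)

theorem exists_norm_Gamma_inv_affine_le {α : ℝ} (hα : α ∈ Ioo (0 : ℝ) 2) (β : ℝ) :
    ∃ C θ : ℝ, 0 ≤ C ∧ θ < Real.pi ∧ ∀ s : ℂ, |s.re| ≤ 1 / 2 →
      ‖(Complex.Gamma (β - α * s))⁻¹‖ ≤ C * Real.exp (θ * |s.im|) := by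
  obtain ⟨h0, h2⟩ := hα
  have hpi := Real.pi_pos
  obtain ⟨m, hm⟩ := exists_nat_ge (1 / 2 - (β - α))
  -- With this `ε` the rate `(π / 2 + ε) * α` is the midpoint of `π α / 2` and `π`.
  have hε : 0 < Real.pi * (2 - α) / (4 * α) := by
    have : 0 < 2 - α := by linarith
    positivity
  obtain ⟨C, hC0, hC⟩ := exists_norm_Gamma_inv_le hε m (β + α)
  refine ⟨C, (Real.pi / 2 + Real.pi * (2 - α) / (4 * α)) * α, hC0, ?_, fun s hs => ?_⟩
  · have : (Real.pi / 2 + Real.pi * (2 - α) / (4 * α)) * α = Real.pi * (1 / 2 + α / 4) := by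
      field_simp; ring
    rw [this]
    nlinarith
  · have hre : ((β : ℂ) - α * s).re = β - α * s.re := by simp
    have him : |((β : ℂ) - α * s).im| = α * |s.im| := by
      simp [abs_mul, abs_of_pos h0]
    rw [abs_le] at hs
    have := hC (β - α * s) (by rw [hre]; nlinarith) (by rw [hre]; nlinarith)
    rwa [him, ← mul_assoc] at this

theorem exists_norm_barnesKernel_le {α : ℝ} (hα : α ∈ Ioo (0 : ℝ) 2) (β x : ℝ) :
    ∃ C θ : ℝ, θ < Real.pi ∧ ∀ s : ℂ, |s.re| ≤ 1 / 2 →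
      ‖barnesKernel α β x s‖ ≤ C * Real.exp (θ * |s.im|) := by
  obtain ⟨C, θ, hC0, hθ, hC⟩ := exists_norm_Gamma_inv_affine_le hα β
  refine ⟨Real.exp |Real.log x| * C, θ, hθ, fun s hs => ?_⟩
  rw [barnesKernel, norm_mul, Complex.norm_exp, mul_assoc]
  refine mul_le_mul (Real.exp_le_exp.2 ?_) (hC s hs) (norm_nonneg _) (Real.exp_pos _).le
  have : (-(Real.log x : ℂ) * s).re = -(Real.log x * s.re) := by simp
  rw [this]
  refine (neg_le_abs _).trans ?_
  rw [abs_mul]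
  exact mul_le_of_le_one_right (abs_nonneg _) (by linarith)

theorem exp_log_mul_half {x : ℝ} (hx : 0 < x) : Real.exp (-(Real.log x * (1 / 2))) =
    x ^ (-(1 / 2) : ℝ) := by
  rw [Real.rpow_def_of_pos hx]; congr 1; ring

theorem norm_barnesKernel_half {x : ℝ} (hx : 0 < x) (α β y : ℝ) :
    ‖barnesKernel α β x (((1 / 2 : ℝ) : ℂ) + (y : ℂ) * Complex.I)‖ = x ^ (-(1 / 2) : ℝ) *
      ‖(Complex.Gamma (β - α * (((1 / 2 : ℝ) : ℂ) + (y : ℂ) * Complex.I)))⁻¹‖ := by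
  rw [barnesKernel, norm_mul, Complex.norm_exp, ← exp_log_mul_half hx]
  congr 2
  simp

/-- The contour shift across the pole at `0`. -/
theorem barnesIntegral_add {α : ℝ} (hα : α ∈ Ioo (0 : ℝ) 2) (β : ℝ) {x : ℝ} (hx : 0 < x) :
    barnesIntegral α β x + x * barnesIntegral α (β + α) x =
      (((Real.Gamma β)⁻¹ : ℝ) : ℂ) := by
  obtain ⟨C, θ, hθ, hC⟩ := exists_norm_barnesKernel_le hα β x
  have key := integral_strip_div_cosh (differentiable_barnesKernel α β x) hθ hC
  have hshift (y : ℝ) : barnesKernel α β x (((-(1 / 2) : ℝ) : ℂ) + (y : ℂ) * Complex.I) =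
      x * barnesKernel α (β + α) x (((1 / 2 : ℝ) : ℂ) + (y : ℂ) * Complex.I) := by
    rw [barnesKernel, barnesKernel, ← mul_assoc]
    congr 1
    · have : (x : ℂ) = Complex.exp (Real.log x) := by
        rw [← Complex.ofReal_exp, Real.exp_log hx]
      conv_rhs => rw [this]
      rw [← Complex.exp_add]
      congr 1; push_cast; ring
    · congr 2; push_cast; ring
  simp_rw [hshift, mul_div_assoc] at key
  rw [integral_const_mul] at key
  have h0 : barnesKernel α β x 0 = (((Real.Gamma β)⁻¹ : ℝ) : ℂ) := by
    simp [barnesKernel, Complex.Gamma_ofReal]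
  rw [h0] at key
  rw [barnesIntegral, barnesIntegral]
  linear_combination key / 2

theorem norm_barnesIntegral_le {α β C θ : ℝ} (hθ : θ < Real.pi)
    (hC : ∀ y : ℝ, ‖(Complex.Gamma (β - α * (((1 / 2 : ℝ) : ℂ) + (y : ℂ) * Complex.I)))⁻¹‖ ≤
      C * Real.exp (θ * |y|)) {x : ℝ} (hx : 0 < x) :
    ‖barnesIntegral α β x‖ ≤
      C * (∫ y : ℝ, Real.exp (-(Real.pi - θ) * |y|)) * x ^ (-(1 / 2) : ℝ) := by
  have hint := integrable_exp_neg_mul_abs (sub_pos.2 hθ)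
  have hle := norm_integral_le_of_norm_le
    (f := fun y : ℝ => barnesKernel α β x (((1 / 2 : ℝ) : ℂ) + (y : ℂ) * Complex.I) /
      ((Real.cosh (Real.pi * y) : ℝ) : ℂ))
    (hint.const_mul (x ^ (-(1 / 2) : ℝ) * C * 2)) (ae_of_all _ fun y => ?_)
  · rw [integral_const_mul] at hle
    rw [barnesIntegral, norm_mul]
    have : ‖(1 / 2 : ℂ)‖ = 1 / 2 := by norm_num
    rw [this]
    linarith
  · have hc := Real.cosh_pos (Real.pi * y)
    have h2 := inv_cosh_le (Real.pi * y)
    rw [abs_mul, abs_of_pos Real.pi_pos] at h2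
    rw [norm_div, Complex.norm_real, Real.norm_of_nonneg hc.le, div_eq_mul_inv,
      norm_barnesKernel_half hx]
    have h0 := (norm_nonneg _).trans (hC y)
    have h3 : 0 < x ^ (-(1 / 2) : ℝ) := Real.rpow_pos_of_pos hx _
    calc _ ≤ (x ^ (-(1 / 2) : ℝ) * (C * Real.exp (θ * |y|))) *
          (2 * Real.exp (-(Real.pi * |y|))) := by
          gcongr
          exact hC y
      _ = x ^ (-(1 / 2) : ℝ) * C * 2 *
          (Real.exp (θ * |y|) * Real.exp (-(Real.pi * |y|))) := by ring
      _ = _ := by rw [← Real.exp_add]; congr 2; ring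

theorem exists_norm_barnesIntegral_le {α : ℝ} (hα : α ∈ Ioo (0 : ℝ) 2) (β : ℝ) :
    ∃ C : ℝ, ∀ x : ℝ, 0 < x → ‖barnesIntegral α β x‖ ≤ C * x ^ (-(1 / 2) : ℝ) := by
  obtain ⟨C, θ, -, hθ, hC⟩ := exists_norm_Gamma_inv_affine_le hα β
  refine ⟨_, fun x hx => norm_barnesIntegral_le hθ (C := C) (fun y => ?_) hx⟩
  simpa using hC (((1 / 2 : ℝ) : ℂ) + (y : ℂ) * Complex.I) (by norm_num [abs_of_pos])

/-- Here the constant is independent of `β`, as needed when `β` is replaced by `α N + β` with `N →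
∞`. -/
theorem exists_norm_barnesIntegral_le_div_Gamma {α : ℝ} (hα : α ∈ Ioo (0 : ℝ) 2) {x : ℝ}
    (hx : 0 < x) : ∃ C : ℝ, 0 ≤ C ∧ ∀ β : ℝ, 1 / 2 ≤ β - α / 2 →
      ‖barnesIntegral α β x‖ ≤ C * (Real.Gamma (β - α / 2))⁻¹ := by
  have hθ : Real.pi / 2 * α < Real.pi := by nlinarith [Real.pi_pos, hα.2]
  refine ⟨(∫ y : ℝ, Real.exp (-(Real.pi - Real.pi / 2 * α) * |y|)) * x ^ (-(1 / 2) : ℝ),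
    mul_nonneg (integral_nonneg fun y => (Real.exp_pos _).le) (Real.rpow_pos_of_pos hx _).le,
    fun β hβ => ?_⟩
  refine (norm_barnesIntegral_le hθ (C := (Real.Gamma (β - α / 2))⁻¹)
    (fun y => ?_) hx).trans_eq (by ring)
  have h := norm_Gamma_inv_le hβ (-(α * y))
  have e : (((β - α / 2 : ℝ) : ℂ)) + ((-(α * y) : ℝ) : ℂ) * Complex.I =
      β - α * (((1 / 2 : ℝ) : ℂ) + (y : ℂ) * Complex.I) := by push_cast; ring
  rwa [e, abs_neg, abs_mul, abs_of_pos hα.1, ← mul_assoc] at h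

/-- Up to the factor `x ^ (-1/2)`, the variable enters only through the unimodular `exp (-i y log
x)`, so dominated convergence applies. The result serves the integrability of the integrand of
`psi`. -/
theorem continuousOn_barnesIntegral {α : ℝ} (hα : α ∈ Ioo (0 : ℝ) 2) (β : ℝ) :
    ContinuousOn (barnesIntegral α β) (Ioi 0) := by
  obtain ⟨C, θ, hC0, hθ, hC⟩ := exists_norm_Gamma_inv_affine_le hα β
  set g : ℝ → ℂ := fun y =>
    (Complex.Gamma (β - α * (((1 / 2 : ℝ) : ℂ) + (y : ℂ) * Complex.I)))⁻¹ with hg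
  have hgc : Continuous g :=
    Complex.differentiable_one_div_Gamma.continuous.comp
      (continuous_const.sub (continuous_const.mul (continuous_ofReal_add_mul_I _)))
  have hgi : Integrable fun y : ℝ => g y / ((Real.cosh (Real.pi * y) : ℝ) : ℂ) := by
    refine integrable_div_cosh hgc hθ (C := C) fun y => ?_
    simpa [hg] using hC (((1 / 2 : ℝ) : ℂ) + (y : ℂ) * Complex.I) (by norm_num [abs_of_pos])
  have hF : Continuous fun u : ℝ => ∫ y : ℝ,
      Complex.exp (((-(u * y) : ℝ) : ℂ) * Complex.I) *
        (g y / ((Real.cosh (Real.pi * y) : ℝ) : ℂ)) := by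
    refine continuous_of_dominated (fun u => ?_) (fun u => ae_of_all _ fun y => ?_) hgi.norm
      (ae_of_all _ fun y => ?_)
    · refine AEStronglyMeasurable.mul (Continuous.aestronglyMeasurable ?_)
        hgi.aestronglyMeasurable
      fun_prop
    · rw [norm_mul, Complex.norm_exp_ofReal_mul_I, one_mul]
    · fun_prop
  have heq : ∀ x ∈ Ioi (0 : ℝ), barnesIntegral α β x =
      1 / 2 * (Complex.exp (-((Real.log x * (1 / 2) : ℝ) : ℂ)) * ∫ y : ℝ,
        Complex.exp (((-(Real.log x * y) : ℝ) : ℂ) * Complex.I) *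
          (g y / ((Real.cosh (Real.pi * y) : ℝ) : ℂ))) := by
    intro x _
    rw [barnesIntegral, ← integral_const_mul (Complex.exp _)]
    congr 2
    funext y
    rw [barnesKernel, mul_div_assoc, ← mul_assoc, ← Complex.exp_add]
    congr 2
    push_cast; ring
  refine ContinuousOn.congr ?_ heq
  have hlog : ContinuousOn Real.log (Ioi 0) :=
    Real.continuousOn_log.mono fun x hx => (ne_of_gt hx)
  refine continuousOn_const.mul (ContinuousOn.mul ?_ (hF.comp_continuousOn hlog))
  have : Continuous fun u : ℝ => Complex.exp (-((u * (1 / 2) : ℝ) : ℂ)) := by fun_prop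
  exact this.comp_continuousOn hlog

theorem barnesIntegral_eq_sum {α : ℝ} (hα : α ∈ Ioo (0 : ℝ) 2) (β : ℝ) {x : ℝ} (hx : 0 < x)
    (N : ℕ) : barnesIntegral α β x =
      (∑ k ∈ Finset.range N, (((-x) ^ k / Real.Gamma (α * k + β) : ℝ) : ℂ)) +
        (-x : ℂ) ^ N * barnesIntegral α (α * N + β) x := by
  induction N with
  | zero => simp
  | succ N ih =>
    rw [ih, Finset.sum_range_succ]
    have h := barnesIntegral_add hα (α * N + β) hx
    have e : α * ((N + 1 : ℕ) : ℝ) + β = α * N + β + α := by push_cast; ring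
    rw [e]
    push_cast at h ⊢
    rw [pow_succ]
    linear_combination ((-x : ℂ) ^ N) * h

/-- The contour-shift recurrence is solved for the integral with the larger parameter. Starting from
`β = α`, the residues are taken at `0, -α, -2α, …`. -/
theorem barnesIntegral_eq_sum_inv {α : ℝ} (hα : α ∈ Ioo (0 : ℝ) 2) {x : ℝ}
    (hx : 0 < x) (N : ℕ) : barnesIntegral α α x =
      (∑ k ∈ Finset.range N, (((-1) ^ k * (Real.Gamma (-(α * k)))⁻¹ * (x⁻¹) ^ (k + 1) : ℝ) : ℂ)) +
        (-1) ^ N * (x⁻¹ : ℂ) ^ N * barnesIntegral α (α - α * N) x := by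
  induction N with
  | zero => simp
  | succ N ih =>
    rw [ih, Finset.sum_range_succ]
    have h := barnesIntegral_add hα (-(α * N)) hx
    have e : α - α * ((N + 1 : ℕ) : ℝ) = -(α * N) := by push_cast; ring
    have e' : -(α * N) + α = α - α * N := by ring
    rw [e]
    rw [e'] at h
    have hx' : (x : ℂ) ≠ 0 := by exact_mod_cast hx.ne'
    have hxi : (x : ℂ)⁻¹ * x = 1 := inv_mul_cancel₀ hx'
    push_cast at h ⊢
    rw [pow_succ, pow_succ]
    linear_combination ((-1 : ℂ) ^ N * (x : ℂ)⁻¹ ^ N * (x : ℂ)⁻¹) * h -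
      ((-1 : ℂ) ^ N * (x : ℂ)⁻¹ ^ N * barnesIntegral α (α - α * N) x) * hxi

/-! ### Identification with the power series -/

/-- Only the tail `r > X` of Euler's integral is kept, where `r ^ (u - 1) ≥ X ^ (u - 1)`. -/
theorem rpow_mul_exp_neg_le_Gamma {u X : ℝ} (hu : 1 ≤ u) (hX : 0 < X) :
    X ^ (u - 1) * Real.exp (-X) ≤ Real.Gamma u := by
  have hu0 : 0 < u := by linarith
  rw [Real.Gamma_eq_integral hu0, ← integral_exp_neg_Ioi X, ← integral_const_mul]
  have hi := Real.GammaIntegral_convergent hu0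
  calc ∫ r in Ioi X, X ^ (u - 1) * Real.exp (-r)
      ≤ ∫ r in Ioi X, Real.exp (-r) * r ^ (u - 1) := by
        refine setIntegral_mono_on ?_ (hi.mono_set (Ioi_subset_Ioi hX.le)) measurableSet_Ioi ?_
        · exact (integrableOn_exp_neg_Ioi X).const_mul _
        · intro r hr
          rw [mul_comm]
          have := (mem_Ioi.1 hr).le
          gcongr
    _ ≤ _ := by
        refine setIntegral_mono_set hi ?_ (Ioi_subset_Ioi hX.le).eventuallyLE
        filter_upwards [self_mem_ae_restrict measurableSet_Ioi] with r hr
        exact mul_nonneg (Real.exp_pos _).le (Real.rpow_nonneg (mem_Ioi.1 hr).le _)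

theorem exists_pow_div_Gamma_le {α : ℝ} (hα : 0 < α) (b : ℝ) {x : ℝ} (hx : 0 < x) :
    ∃ C : ℝ, ∀ᶠ N : ℕ in atTop, 1 ≤ α * N + b ∧
      x ^ N * (Real.Gamma (α * N + b))⁻¹ ≤ C * (1 / 2) ^ N := by
  -- Chosen so that `X ^ α = 2 * x`, which makes the quotient decay like `(1 / 2) ^ N`.
  set X := (2 * x) ^ (α⁻¹) with hX
  have hX0 : 0 < X := Real.rpow_pos_of_pos (by positivity) _
  have hXα : X ^ α = 2 * x := by
    rw [hX, ← Real.rpow_mul (by positivity), inv_mul_cancel₀ hα.ne', Real.rpow_one]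
  refine ⟨Real.exp X * (X ^ (b - 1))⁻¹, ?_⟩
  have ht : Tendsto (fun N : ℕ => α * (N : ℝ) + b) atTop atTop :=
    tendsto_atTop_add_const_right _ _ (tendsto_natCast_atTop_atTop.const_mul_atTop hα)
  filter_upwards [ht.eventually_ge_atTop 1] with N hN
  refine ⟨hN, ?_⟩
  have h := rpow_mul_exp_neg_le_Gamma hN hX0
  have e : X ^ (α * N + b - 1) = (2 * x) ^ N * X ^ (b - 1) := by
    rw [add_sub_assoc, Real.rpow_add hX0, Real.rpow_mul hX0.le, hXα, Real.rpow_natCast]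
  have hXb : 0 < X ^ (b - 1) := Real.rpow_pos_of_pos hX0 _
  have hE := Real.exp_pos (-X)
  calc x ^ N * (Real.Gamma (α * N + b))⁻¹
      ≤ x ^ N * (X ^ (α * N + b - 1) * Real.exp (-X))⁻¹ := by
        gcongr
    _ = _ := by
        rw [e, Real.exp_neg, mul_pow, one_div, inv_pow]
        have := Real.exp_pos X
        field_simp

/-- The geometric bound `exists_pow_div_Gamma_le` is used twice: with `b = β` for summability, and
with `b = β - α / 2` for the remainder of the iterated recurrence. -/
theorem hasSum_barnesIntegral {α : ℝ} (hα : α ∈ Ioo (0 : ℝ) 2) (β : ℝ) {x : ℝ} (hx : 0 < x) :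
    HasSum (fun k : ℕ => (((-x) ^ k / Real.Gamma (α * k + β) : ℝ) : ℂ))
      (barnesIntegral α β x) := by
  have hgeom : Summable fun N : ℕ => ((1 : ℝ) / 2) ^ N :=
    summable_geometric_of_lt_one (by norm_num) (by norm_num)
  have hsum : Summable fun k : ℕ => (((-x) ^ k / Real.Gamma (α * k + β) : ℝ) : ℂ) := by
    obtain ⟨C, hC⟩ := exists_pow_div_Gamma_le hα.1 β hx
    refine Summable.of_norm_bounded_eventually_nat (hgeom.mul_left C) ?_
    filter_upwards [hC] with N hN
    rw [Complex.norm_real, norm_div, norm_pow, norm_neg, Real.norm_of_nonneg hx.le,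
      Real.norm_of_nonneg (Real.Gamma_pos_of_pos (by linarith [hN.1])).le, div_eq_mul_inv]
    exact hN.2
  have hrem : Tendsto (fun N : ℕ => (-x : ℂ) ^ N * barnesIntegral α (α * N + β) x) atTop
      (𝓝 0) := by
    obtain ⟨K, hK0, hK⟩ := exists_norm_barnesIntegral_le_div_Gamma hα hx
    obtain ⟨C, hC⟩ := exists_pow_div_Gamma_le hα.1 (β - α / 2) hx
    have hz : Tendsto (fun N : ℕ => K * (C * ((1 : ℝ) / 2) ^ N)) atTop (𝓝 (K * (C * 0))) :=
      ((tendsto_pow_atTop_nhds_zero_of_lt_one (by norm_num) (by norm_num)).const_mul C).const_mul K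
    simp only [mul_zero] at hz
    refine squeeze_zero_norm' ?_ hz
    filter_upwards [hC] with N hN
    have h := hK (α * N + β) (by linarith [hN.1])
    rw [norm_mul, norm_pow, norm_neg, Complex.norm_real, Real.norm_of_nonneg hx.le]
    have e : α * N + β - α / 2 = α * N + (β - α / 2) := by ring
    rw [e] at h
    calc x ^ N * ‖barnesIntegral α (α * N + β) x‖
        ≤ x ^ N * (K * (Real.Gamma (α * N + (β - α / 2)))⁻¹) := by gcongr
      _ = K * (x ^ N * (Real.Gamma (α * N + (β - α / 2)))⁻¹) := by ring
      _ ≤ _ := mul_le_mul_of_nonneg_left hN.2 hK0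
  rw [hsum.hasSum_iff_tendsto_nat]
  have h2 := (tendsto_const_nhds (x := barnesIntegral α β x)).sub hrem
  rw [sub_zero] at h2
  refine h2.congr fun N => ?_
  rw [barnesIntegral_eq_sum hα β hx N]
  ring

theorem ofReal_mittagLeffler {α : ℝ} (hα : α ∈ Ioo (0 : ℝ) 2) (β : ℝ) {x : ℝ} (hx : 0 < x) :
    ((mittagLeffler α β (-x) : ℝ) : ℂ) = barnesIntegral α β x := by
  rw [mittagLeffler, Complex.ofReal_tsum, ← (hasSum_barnesIntegral hα β hx).tsum_eq]
  rfl

theorem continuousOn_mittagLeffler_neg {α : ℝ} (hα : α ∈ Ioo (0 : ℝ) 2) (β : ℝ) :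
    ContinuousOn (fun x : ℝ => mittagLeffler α β (-x)) (Ioi 0) := by
  refine (Complex.continuous_re.comp_continuousOn (continuousOn_barnesIntegral hα β)).congr ?_
  intro x hx
  simp [← ofReal_mittagLeffler hα β (mem_Ioi.1 hx)]

/-- The coefficients of the expansion of `E_{α,α}(-x)` in powers of `1 / x` at infinity. -/
noncomputable def mlCoeff (α : ℝ) (k : ℕ) : ℝ := (-1) ^ k * (Real.Gamma (-(α * k)))⁻¹

/-- The asymptotic expansion of `E_{α,α}(-x)` as `x → ∞`. -/
theorem exists_abs_mittagLeffler_sub_le {α : ℝ} (hα : α ∈ Ioo (0 : ℝ) 2) (N : ℕ) :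
    ∃ C : ℝ, 0 ≤ C ∧ ∀ x : ℝ, 0 < x →
      |mittagLeffler α α (-x) - ∑ k ∈ Finset.range N, mlCoeff α k * (x⁻¹) ^ (k + 1)| ≤
        C * x ^ (-(N + 1 / 2) : ℝ) := by
  obtain ⟨C, hC⟩ := exists_norm_barnesIntegral_le hα (α - α * N)
  have hC0 : 0 ≤ C := by
    have := (norm_nonneg _).trans (hC 1 one_pos)
    simpa using this
  refine ⟨C, hC0, fun x hx => ?_⟩
  have h := ofReal_mittagLeffler hα α hx
  rw [barnesIntegral_eq_sum_inv hα hx N, ← sub_eq_iff_eq_add', ← Complex.ofReal_sum,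
    ← Complex.ofReal_sub] at h
  rw [← Real.norm_eq_abs, ← Complex.norm_real]
  simp only [mlCoeff]
  rw [h, norm_mul, norm_mul, norm_pow, norm_pow, norm_neg, norm_one, one_pow, one_mul, norm_inv,
    Complex.norm_real, Real.norm_of_nonneg hx.le]
  calc x⁻¹ ^ N * ‖barnesIntegral α (α - α * N) x‖ ≤ x⁻¹ ^ N * (C * x ^ (-(1 / 2) : ℝ)) := by
        gcongr
        exact hC x hx
    _ = _ := by
        have e : (-(N + 1 / 2) : ℝ) = -(N : ℝ) + -(1 / 2) := by ring
        rw [e, Real.rpow_add hx, Real.rpow_neg hx.le (N : ℝ), Real.rpow_natCast, inv_pow]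
        ring

/-! ### Moments -/

theorem integral_polynomial_mul_eq_zero {t₀ : ℝ} {μ : ℝ → ℝ}
    (hμ : IntervalIntegrable μ volume 0 t₀)
    (hmom : ∀ j : ℕ, ∫ s in (0 : ℝ)..t₀, s ^ j * μ s = 0) (p : Polynomial ℝ) :
    ∫ s in (0 : ℝ)..t₀, p.eval s * μ s = 0 := by
  simp_rw [Polynomial.eval_eq_sum_range, Finset.sum_mul, mul_assoc]
  rw [intervalIntegral.integral_finsetSum]
  · simp [hmom]
  · intro j _
    exact (hμ.continuousOn_mul (continuous_pow j).continuousOn).const_mul _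

/-- Weierstrass approximation: a uniform error `ε` costs at most `ε` times the `L¹` norm of `μ`. -/
theorem integral_continuous_mul_eq_zero {t₀ : ℝ} (ht₀ : 0 < t₀) {μ : ℝ → ℝ}
    (hμ : IntervalIntegrable μ volume 0 t₀)
    (hmom : ∀ j : ℕ, ∫ s in (0 : ℝ)..t₀, s ^ j * μ s = 0) {g : ℝ → ℝ} (hg : Continuous g) :
    ∫ s in (0 : ℝ)..t₀, g s * μ s = 0 := by
  have hbound (ε : ℝ) (hε : 0 < ε) :
      |∫ s in (0 : ℝ)..t₀, g s * μ s| ≤ ε * ∫ s in (0 : ℝ)..t₀, |μ s| := by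
    obtain ⟨p, hp⟩ := exists_polynomial_near_of_continuousOn 0 t₀ g hg.continuousOn ε hε
    have hpi := hμ.continuousOn_mul (p.continuous.continuousOn (s := uIcc 0 t₀))
    have hgi := hμ.continuousOn_mul (hg.continuousOn (s := uIcc 0 t₀))
    have h0 := integral_polynomial_mul_eq_zero hμ hmom p
    have h1 := intervalIntegral.integral_sub hgi hpi
    rw [h0, sub_zero] at h1
    rw [← h1, ← intervalIntegral.integral_const_mul,
      ← Real.norm_eq_abs]
    refine intervalIntegral.norm_integral_le_of_norm_le ht₀.le (ae_of_all _ fun s hs => ?_)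
      (hμ.abs.const_mul ε)
    rw [← sub_mul, norm_mul, Real.norm_eq_abs, Real.norm_eq_abs, abs_sub_comm]
    gcongr
    exact (hp s ⟨hs.1.le, hs.2⟩).le
  set K := ∫ s in (0 : ℝ)..t₀, |μ s| with hK
  have ht : Tendsto (fun ε : ℝ => ε * K) (𝓝[>] 0) (𝓝 (0 * K)) :=
    (tendsto_id.mul_const K).mono_left nhdsWithin_le_nhds
  rw [zero_mul] at ht
  have hle := ge_of_tendsto ht (eventually_nhdsWithin_of_forall hbound)
  exact abs_eq_zero.1 (le_antisymm hle (abs_nonneg _))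

/-- The Hausdorff moment problem on `(0, t₀)` is determinate. -/
theorem ae_eq_zero_of_moments_eq_zero {t₀ : ℝ} (ht₀ : 0 < t₀) {μ : ℝ → ℝ}
    (hμ : IntervalIntegrable μ volume 0 t₀)
    (hmom : ∀ j : ℕ, ∫ s in (0 : ℝ)..t₀, s ^ j * μ s = 0) :
    ∀ᵐ s ∂(volume.restrict (Ioo 0 t₀)), μ s = 0 := by
  have hon : IntegrableOn μ (Ioo 0 t₀) :=
    ((intervalIntegrable_iff_integrableOn_Ioc_of_le ht₀.le).1 hμ).mono_set Ioo_subset_Ioc_self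
  rw [ae_restrict_iff' measurableSet_Ioo]
  refine isOpen_Ioo.ae_eq_zero_of_integral_contDiff_smul_eq_zero hon.locallyIntegrableOn
    fun g hg _ hsub => ?_
  rw [← integral_continuous_mul_eq_zero ht₀ hμ hmom hg.continuous,
    intervalIntegral.integral_of_le ht₀.le, ← setIntegral_univ]
  simp only [smul_eq_mul]
  refine setIntegral_eq_of_subset_of_forall_sdiff_eq_zero MeasurableSet.univ (subset_univ _) ?_
  intro s hs
  have : s ∉ tsupport g := fun h => hs.2 (Ioo_subset_Ioc_self (hsub h))
  rw [image_eq_zero_of_notMem_tsupport this, zero_mul]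

/-! ### Convolution with a power -/

/-- The integral `∫₀^{t₀} (t - s) ^ (-γ) μ(s) ds`. -/
noncomputable def powerConv (t₀ : ℝ) (μ : ℝ → ℝ) (γ t : ℝ) : ℝ :=
  ∫ s in (0 : ℝ)..t₀, (t - s) ^ (-γ) * μ s

/-- This is the coefficient of `u ^ n` in `(1 - u) ^ (-γ)`; its positivity keeps the leading
coefficient of `powerConv` from vanishing. -/
theorem multichoose_pos {γ : ℝ} (hγ : 0 < γ) (n : ℕ) : 0 < Ring.choose (γ + n - 1) n := by
  rw [← Ring.multichoose_eq]
  have h := Ring.factorial_nsmul_multichoose_eq_ascPochhammer γ n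
  rw [Polynomial.ascPochhammer_smeval_eq_eval, nsmul_eq_mul] at h
  have h1 := ascPochhammer_pos n γ hγ
  rw [← h] at h1
  exact pos_of_mul_pos_right h1 (by positivity)

theorem exists_abs_one_sub_rpow_sub_le (γ : ℝ) (n : ℕ) :
    ∃ C δ : ℝ, 0 < δ ∧ δ ≤ 1 ∧ ∀ u : ℝ, |u| < δ →
      |(1 - u) ^ (-γ) - ∑ j ∈ Finset.range n, Ring.choose (γ + j - 1) j * u ^ j| ≤
        C * |u| ^ n := by
  have h := (Real.one_div_one_sub_rpow_hasFPowerSeriesOnBall_zero γ).hasFPowerSeriesAt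
  obtain ⟨C, hC⟩ := (h.isBigO_sub_partialSum_pow n).bound
  obtain ⟨δ, hδ, hball⟩ := Metric.eventually_nhds_iff.1 hC
  refine ⟨C, min δ 1, lt_min hδ one_pos, min_le_right _ _, fun u hu => ?_⟩
  have := hball (y := u) (by simpa using hu.trans_le (min_le_left _ _))
  have h1 : (0 : ℝ) ≤ 1 - u := by
    have := (abs_lt.1 (hu.trans_le (min_le_right _ _))).2
    linarith
  simpa [FormalMultilinearSeries.partialSum, FormalMultilinearSeries.ofScalars_apply_eq,
    Real.rpow_neg h1, mul_comm] using this

theorem intervalIntegrable_comp_sub_mul {t₀ : ℝ} (ht₀ : 0 < t₀) {μ : ℝ → ℝ}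
    (hμ : IntervalIntegrable μ volume 0 t₀) {g : ℝ → ℝ} (hg : ContinuousOn g (Ioi 0))
    {t : ℝ} (ht : t₀ < t) : IntervalIntegrable (fun s => g (t - s) * μ s) volume 0 t₀ := by
  refine hμ.continuousOn_mul (hg.comp (continuous_const.sub continuous_id).continuousOn ?_)
  intro s hs
  rw [uIcc_of_le ht₀.le] at hs
  exact mem_Ioi.2 (sub_pos.2 (hs.2.trans_lt ht))

theorem continuousOn_rpow_Ioi (e : ℝ) : ContinuousOn (fun x : ℝ => x ^ e) (Ioi 0) :=
  continuousOn_id.rpow_const fun _ hx => Or.inl (ne_of_gt hx)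

/-- The leading term of `powerConv` at infinity is governed by the first nonzero moment. -/
theorem tendsto_rpow_mul_powerConv {t₀ : ℝ} (ht₀ : 0 < t₀) {μ : ℝ → ℝ}
    (hμ : IntervalIntegrable μ volume 0 t₀) (γ : ℝ) {m : ℕ}
    (hm : ∀ j < m, ∫ s in (0 : ℝ)..t₀, s ^ j * μ s = 0) :
    Tendsto (fun t : ℝ => t ^ (γ + m) * powerConv t₀ μ γ t) atTop
      (𝓝 (Ring.choose (γ + m - 1) m * ∫ s in (0 : ℝ)..t₀, s ^ m * μ s)) := by
  -- Expanding through degree `m` leaves an error of order `(s / t) ^ (m + 1)`, hence `O(t⁻¹)` after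
  -- multiplication by `t ^ m`.
  obtain ⟨C, δ, hδ, hδ1, hC⟩ := exists_abs_one_sub_rpow_sub_le γ (m + 1)
  set b : ℕ → ℝ := fun j => Ring.choose (γ + j - 1) j with hb
  set K := ∫ s in (0 : ℝ)..t₀, |C| * t₀ ^ (m + 1) * |μ s| with hK
  have hz : Tendsto (fun t : ℝ => K * t⁻¹) atTop (𝓝 0) := by
    simpa using tendsto_inv_atTop_zero.const_mul K
  rw [tendsto_iff_norm_sub_tendsto_zero]
  refine squeeze_zero' (Eventually.of_forall fun _ => norm_nonneg _) ?_ hz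
  filter_upwards [eventually_gt_atTop (t₀ / δ), eventually_gt_atTop t₀] with t ht1 ht2
  have ht : 0 < t := ht₀.trans ht2
  have hpoly : ∫ s in (0 : ℝ)..t₀,
      t ^ m * (∑ j ∈ Finset.range (m + 1), b j * (s / t) ^ j) * μ s =
        b m * ∫ s in (0 : ℝ)..t₀, s ^ m * μ s := by
    have e : ∀ s : ℝ, t ^ m * (∑ j ∈ Finset.range (m + 1), b j * (s / t) ^ j) * μ s =
        ∑ j ∈ Finset.range (m + 1), (t ^ m * b j / t ^ j) * (s ^ j * μ s) := by
      intro s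
      rw [Finset.mul_sum, Finset.sum_mul]
      refine Finset.sum_congr rfl fun j _ => ?_
      rw [div_pow]; ring
    simp_rw [e]
    rw [intervalIntegral.integral_finsetSum]
    · simp_rw [intervalIntegral.integral_const_mul]
      rw [Finset.sum_range_succ, Finset.sum_eq_zero, zero_add]
      · field_simp
      · intro j hj
        rw [hm j (Finset.mem_range.1 hj), mul_zero]
    · intro j _
      exact (hμ.continuousOn_mul (continuous_pow j).continuousOn).const_mul _
  have hker : t ^ (γ + m) * powerConv t₀ μ γ t =
      ∫ s in (0 : ℝ)..t₀, t ^ m * (1 - s / t) ^ (-γ) * μ s := by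
    rw [powerConv, ← intervalIntegral.integral_const_mul]
    refine intervalIntegral.integral_congr fun s hs => ?_
    rw [uIcc_of_le ht₀.le] at hs
    have e : t - s = t * (1 - s / t) := by field_simp
    have e1 : 0 ≤ 1 - s / t := by
      rw [sub_nonneg, div_le_one ht]; linarith [hs.2]
    rw [e, Real.mul_rpow ht.le e1, Real.rpow_add ht, Real.rpow_natCast, Real.rpow_neg ht.le]
    have := (Real.rpow_pos_of_pos ht γ).ne'
    field_simp
  have hcont : IntervalIntegrable (fun s => t ^ m * (1 - s / t) ^ (-γ) * μ s) volume 0 t₀ := by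
    refine hμ.continuousOn_mul (continuousOn_const.mul (ContinuousOn.rpow_const ?_ ?_))
    · fun_prop
    · intro s hs
      rw [uIcc_of_le ht₀.le] at hs
      left
      have : s / t < 1 := by rw [div_lt_one ht]; linarith [hs.2]
      linarith
  have hcont' : IntervalIntegrable (fun s =>
      t ^ m * (∑ j ∈ Finset.range (m + 1), b j * (s / t) ^ j) * μ s) volume 0 t₀ := by
    refine hμ.continuousOn_mul (Continuous.continuousOn ?_)
    fun_prop
  rw [hker, ← hpoly, ← intervalIntegral.integral_sub hcont hcont', hK,
    ← intervalIntegral.integral_mul_const]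
  refine intervalIntegral.norm_integral_le_of_norm_le ht₀.le (ae_of_all _ fun s hs => ?_)
    ((hμ.abs.const_mul _).mul_const _)
  have hs0 : |s / t| = s / t := abs_of_nonneg (div_nonneg hs.1.le ht.le)
  have hsδ : |s / t| < δ := by
    rw [hs0, div_lt_iff₀ ht]
    rw [div_lt_iff₀ hδ] at ht1
    linarith [hs.2]
  have h := hC (s / t) hsδ
  rw [hs0] at h
  rw [← sub_mul, ← mul_sub, norm_mul, norm_mul, Real.norm_eq_abs, Real.norm_eq_abs,
    Real.norm_eq_abs, abs_of_pos (pow_pos ht m)]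
  have h2 : t ^ m * |(1 - s / t) ^ (-γ) - ∑ j ∈ Finset.range (m + 1), b j * (s / t) ^ j| ≤
      |C| * t₀ ^ (m + 1) * t⁻¹ := by
    calc _ ≤ t ^ m * (C * (s / t) ^ (m + 1)) := by gcongr
      _ ≤ t ^ m * (|C| * (t₀ / t) ^ (m + 1)) := by
          have := hs.1.le
          have := hs.2
          have := le_abs_self C
          gcongr
      _ = _ := by rw [div_pow, pow_succ t]; field_simp
  calc _ ≤ |C| * t₀ ^ (m + 1) * t⁻¹ * |μ s| := by gcongr
    _ = _ := by ring

/-! ### The expansion of `psi` -/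

/-- The expansion of `E_{α,α}(-x)` is integrated at `x = l * (t - s) ^ α`. The constant is uniform
in `l`, with an explicit power of `l`, so that the estimate can be summed against `a n`. -/
theorem exists_abs_psi_sub_le {α : ℝ} (hα : α ∈ Ioo (0 : ℝ) 2) {t₀ : ℝ} (ht₀ : 0 < t₀)
    {μ : ℝ → ℝ} (hμ : IntervalIntegrable μ volume 0 t₀) (N : ℕ) :
    ∃ C : ℝ, 0 ≤ C ∧ ∀ l : ℝ, 0 < l → ∀ t : ℝ, t₀ < t →
      |psi α t₀ μ l t -
        ∑ k ∈ Finset.range N, mlCoeff α k * (l⁻¹) ^ (k + 1) * powerConv t₀ μ (1 + α * k) t| ≤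
        C * l ^ (-(N + 1 / 2) : ℝ) * (t - t₀) ^ (-(α * N + 1 - α / 2)) := by
  obtain ⟨C, hC0, hC⟩ := exists_abs_mittagLeffler_sub_le hα N
  have hμ1 : 0 ≤ ∫ s in (0 : ℝ)..t₀, |μ s| :=
    intervalIntegral.integral_nonneg ht₀.le fun s _ => abs_nonneg _
  refine ⟨C * ∫ s in (0 : ℝ)..t₀, |μ s|, by positivity, fun l hl t ht => ?_⟩
  have hpc (k : ℕ) : IntervalIntegrable (fun s =>
      mlCoeff α k * (l⁻¹) ^ (k + 1) * ((t - s) ^ (-(1 + α * k)) * μ s)) volume 0 t₀ :=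
    (intervalIntegrable_comp_sub_mul ht₀ hμ (continuousOn_rpow_Ioi _) ht).const_mul _
  have hF : IntervalIntegrable (fun s =>
      (t - s) ^ (α - 1) * mittagLeffler α α (-l * (t - s) ^ α) * μ s) volume 0 t₀ := by
    refine intervalIntegrable_comp_sub_mul ht₀ hμ
      (g := fun τ => τ ^ (α - 1) * mittagLeffler α α (-l * τ ^ α)) ?_ ht
    refine (continuousOn_rpow_Ioi _).mul ?_
    have := (continuousOn_mittagLeffler_neg hα α).comp
      (continuousOn_const.mul (continuousOn_rpow_Ioi α) : ContinuousOn (fun τ => l * τ ^ α) _)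
      fun τ hτ => mem_Ioi.2 (mul_pos hl (Real.rpow_pos_of_pos hτ _))
    refine this.congr fun τ _ => ?_
    simp [neg_mul]
  have hsum : ∑ k ∈ Finset.range N,
      mlCoeff α k * (l⁻¹) ^ (k + 1) * powerConv t₀ μ (1 + α * k) t =
      ∫ s in (0 : ℝ)..t₀, ∑ k ∈ Finset.range N,
        mlCoeff α k * (l⁻¹) ^ (k + 1) * ((t - s) ^ (-(1 + α * k)) * μ s) := by
    rw [intervalIntegral.integral_finsetSum fun k _ => hpc k]
    simp_rw [intervalIntegral.integral_const_mul, powerConv]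
  have hsumi : IntervalIntegrable (fun s => ∑ k ∈ Finset.range N,
      mlCoeff α k * (l⁻¹) ^ (k + 1) * ((t - s) ^ (-(1 + α * k)) * μ s)) volume 0 t₀ := by
    have := IntervalIntegrable.sum (Finset.range N) fun k _ => hpc k
    refine this.congr fun s _ => ?_
    simp
  rw [hsum, psi, ← intervalIntegral.integral_sub hF hsumi]
  have e : C * (∫ s in (0 : ℝ)..t₀, |μ s|) * l ^ (-(N + 1 / 2) : ℝ) *
      (t - t₀) ^ (-(α * N + 1 - α / 2)) =
      ∫ s in (0 : ℝ)..t₀, (C * l ^ (-(N + 1 / 2) : ℝ) *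
        (t - t₀) ^ (-(α * N + 1 - α / 2))) * |μ s| := by
    rw [intervalIntegral.integral_const_mul]; ring
  rw [e, ← Real.norm_eq_abs]
  refine intervalIntegral.norm_integral_le_of_norm_le ht₀.le (ae_of_all _ fun s hs => ?_)
    (hμ.abs.const_mul _)
  set τ := t - s with hτ
  have hτ0 : 0 < τ := by linarith [hs.2]
  have hx : 0 < l * τ ^ α := mul_pos hl (Real.rpow_pos_of_pos hτ0 _)
  have hpow (k : ℕ) : τ ^ (α - 1) * ((l * τ ^ α)⁻¹) ^ (k + 1) =
      (l⁻¹) ^ (k + 1) * τ ^ (-(1 + α * k)) := by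
    have e1 : -(1 + α * k) = α - 1 - α * ((k + 1 : ℕ) : ℝ) := by push_cast; ring
    rw [e1, Real.rpow_sub hτ0 (α - 1), Real.rpow_mul hτ0.le α, Real.rpow_natCast, mul_inv, mul_pow,
      inv_pow (τ ^ α)]
    ring
  have hfac : τ ^ (α - 1) * mittagLeffler α α (-l * τ ^ α) * μ s -
      ∑ k ∈ Finset.range N, mlCoeff α k * (l⁻¹) ^ (k + 1) * (τ ^ (-(1 + α * k)) * μ s) =
      τ ^ (α - 1) * (mittagLeffler α α (-(l * τ ^ α)) -
        ∑ k ∈ Finset.range N, mlCoeff α k * ((l * τ ^ α)⁻¹) ^ (k + 1)) * μ s := by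
    rw [mul_sub, sub_mul, Finset.mul_sum, Finset.sum_mul, neg_mul]
    congr 1
    refine Finset.sum_congr rfl fun k _ => ?_
    linear_combination -(mlCoeff α k * μ s) * hpow k
  rw [hfac, norm_mul, norm_mul, Real.norm_eq_abs, Real.norm_eq_abs, Real.norm_eq_abs,
    abs_of_pos (Real.rpow_pos_of_pos hτ0 _)]
  have hN : (0 : ℝ) ≤ N := by positivity
  have hexp : τ ^ (-(α * N + 1 - α / 2)) ≤ (t - t₀) ^ (-(α * N + 1 - α / 2)) := by
    refine Real.rpow_le_rpow_of_nonpos (by linarith) (by linarith [hs.2]) ?_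
    nlinarith [hα.1, hα.2]
  have hrem : τ ^ (α - 1) * (l * τ ^ α) ^ (-(N + 1 / 2) : ℝ) =
      l ^ (-(N + 1 / 2) : ℝ) * τ ^ (-(α * N + 1 - α / 2)) := by
    have e1 : -(α * N + 1 - α / 2) = (α - 1) + α * (-(N + 1 / 2)) := by ring
    rw [e1, Real.rpow_add hτ0, Real.rpow_mul hτ0.le α, Real.mul_rpow hl.le (by positivity)]
    ring
  have hlp := Real.rpow_pos_of_pos hl (-(N + 1 / 2) : ℝ)
  have hτp := Real.rpow_pos_of_pos hτ0 (α - 1)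
  calc _ ≤ τ ^ (α - 1) * (C * (l * τ ^ α) ^ (-(N + 1 / 2) : ℝ)) * |μ s| := by
        gcongr
        exact hC _ hx
    _ = C * (l ^ (-(N + 1 / 2) : ℝ) * τ ^ (-(α * N + 1 - α / 2))) * |μ s| := by
        rw [← hrem]; ring
    _ ≤ C * (l ^ (-(N + 1 / 2) : ℝ) * (t - t₀) ^ (-(α * N + 1 - α / 2))) * |μ s| := by
        gcongr
    _ = _ := by ring

/-! ### Dirichlet-type series -/

theorem summable_mul_rpow {lam a : ℕ → ℝ} (hpos : ∀ n, 0 < lam n) (hmono : StrictMono lam)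
    (ha : Summable fun n => |a n / lam n|) {e : ℝ} (he : 1 ≤ e) :
    Summable fun n => |a n| * lam n ^ (-e) := by
  refine Summable.of_nonneg_of_le
    (fun n => mul_nonneg (abs_nonneg _) (Real.rpow_nonneg (hpos n).le _)) (fun n => ?_)
    (ha.mul_right (lam 0 ^ (-(e - 1))))
  have h1 : lam n ^ (-e) = (lam n)⁻¹ * lam n ^ (-(e - 1)) := by
    rw [← Real.rpow_neg_one, ← Real.rpow_add (hpos n)]; congr 1; ring
  have h2 : lam n ^ (-(e - 1)) ≤ lam 0 ^ (-(e - 1)) :=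
    Real.rpow_le_rpow_of_nonpos (hpos 0) (hmono.monotone (Nat.zero_le n)) (by linarith)
  have := hpos n
  rw [h1, abs_div, abs_of_pos this, div_eq_mul_inv, mul_assoc]
  gcongr

theorem summable_mul_inv_pow {lam a : ℕ → ℝ} (hpos : ∀ n, 0 < lam n) (hmono : StrictMono lam)
    (ha : Summable fun n => |a n / lam n|) (k : ℕ) :
    Summable fun n => a n * ((lam n)⁻¹) ^ (k + 1) := by
  have h := summable_mul_rpow hpos hmono ha (e := ((k + 1 : ℕ) : ℝ)) (by
    push_cast
    linarith [(Nat.cast_nonneg k : (0 : ℝ) ≤ k)])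
  refine Summable.of_norm (h.congr fun n => ?_)
  rw [norm_mul, Real.norm_eq_abs, Real.norm_of_nonneg (by have := hpos n; positivity),
    Real.rpow_neg (hpos n).le, Real.rpow_natCast, inv_pow]

/-- A sequence is determined by infinitely many of the sums `∑ a n / lam n ^ (k + 1)`. -/
theorem eq_zero_of_frequently_tsum_eq_zero {lam a : ℕ → ℝ} (hpos : ∀ n, 0 < lam n)
    (hmono : StrictMono lam) (ha : Summable fun n => |a n / lam n|)
    (hz : ∃ᶠ k in atTop, ∑' n, a n * ((lam n)⁻¹) ^ (k + 1) = 0) (n : ℕ) : a n = 0 := by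
  induction n using Nat.strong_induction_on with
  | _ n ih =>
  -- The scaling by `lam n ^ (k + 1)` isolates `a n` as `k → ∞`: the terms `i < n` vanish by
  -- induction, and those with `i > n` decay like `(lam n / lam i) ^ (k + 1)`.
  set f : ℕ → ℕ → ℝ := fun k i => (lam n) ^ (k + 1) * (a i * ((lam i)⁻¹) ^ (k + 1)) with hf
  have hfe (k i : ℕ) : f k i = a i * (lam n / lam i) ^ (k + 1) := by
    rw [hf, div_eq_mul_inv, mul_pow]; ring
  have hlim : Tendsto (fun k => ∑' i, f k i) atTop (𝓝 (∑' i, if i = n then a n else 0)) := by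
    refine tendsto_tsum_of_dominated_convergence (bound := fun i => |a i / lam i| * lam n)
      (ha.mul_right _) (fun i => ?_) (Eventually.of_forall fun k i => ?_)
    · rcases lt_trichotomy i n with hi | hi | hi
      · simp [hfe, ih i hi, hi.ne]
      · subst hi
        simp [hfe, div_self (hpos i).ne']
      · simp only [hfe, hi.ne', if_false]
        have hr : lam n / lam i < 1 := (div_lt_one (hpos i)).2 (hmono hi)
        have := ((tendsto_pow_atTop_nhds_zero_of_lt_one
          (div_nonneg (hpos n).le (hpos i).le) hr).comp (tendsto_add_atTop_nat 1)).const_mul (a i)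
        simpa using this
    · rcases lt_or_ge i n with hi | hi
      · simp [hfe, ih i hi]
      · have hr0 : 0 ≤ lam n / lam i := div_nonneg (hpos n).le (hpos i).le
        have hr : lam n / lam i ≤ 1 := (div_le_one (hpos i)).2 (hmono.monotone hi)
        rw [hfe, norm_mul, Real.norm_eq_abs, Real.norm_of_nonneg (pow_nonneg hr0 _)]
        calc |a i| * (lam n / lam i) ^ (k + 1) ≤ |a i| * (lam n / lam i) := by
              gcongr
              exact pow_le_of_le_one hr0 hr (by omega)
          _ = _ := by rw [abs_div, abs_of_pos (hpos i)]; ring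
  rw [tsum_ite_eq] at hlim
  have hfreq : ∃ᶠ k in atTop, ∑' i, f k i = 0 := by
    refine hz.mono fun k hk => ?_
    rw [hf, tsum_mul_left, hk, mul_zero]
  by_contra hne
  exact hfreq ((hlim.eventually_ne hne))

/-- A coefficient vanishes only if `α k` is a natural number. If this held for both `N` and `N + 1`,
the difference `α` would be an integer. -/
theorem frequently_mlCoeff_ne_zero {α : ℝ} (hα : α ∈ Ioo (0 : ℝ) 1 ∪ Ioo (1 : ℝ) 2) :
    ∃ᶠ k in atTop, mlCoeff α k ≠ 0 := by
  rw [frequently_atTop]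
  intro N
  by_contra! hcon
  have hint (k : ℕ) (hk : N ≤ k) : ∃ m : ℕ, α * k = m := by
    have h := hcon k hk
    rw [mlCoeff, mul_eq_zero, or_iff_right (pow_ne_zero _ (by norm_num)), inv_eq_zero,
      Real.Gamma_eq_zero_iff] at h
    obtain ⟨m, hm⟩ := h
    exact ⟨m, neg_injective hm⟩
  obtain ⟨m, hm⟩ := hint N le_rfl
  obtain ⟨m', hm'⟩ := hint (N + 1) (Nat.le_succ N)
  have hαm : α = ((m' - m : ℤ) : ℝ) := by
    push_cast at hm' ⊢
    linarith
  rcases hα with h | h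
  · rw [hαm] at h
    have h1 : (0 : ℤ) < m' - m := by exact_mod_cast h.1
    have h2 : (m' - m : ℤ) < 1 := by exact_mod_cast h.2
    omega
  · rw [hαm] at h
    have h1 : (1 : ℤ) < m' - m := by exact_mod_cast h.1
    have h2 : (m' - m : ℤ) < 2 := by exact_mod_cast h.2
    omega

/-! ### Superpositions of the functions `psi` -/

theorem exists_abs_tsum_psi_sub_le {α : ℝ} (hα : α ∈ Ioo (0 : ℝ) 2) {t₀ : ℝ} (ht₀ : 0 < t₀)
    {μ : ℝ → ℝ} (hμ : IntervalIntegrable μ volume 0 t₀)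
    {lam a : ℕ → ℝ} (hpos : ∀ n, 0 < lam n) (hmono : StrictMono lam)
    (ha : Summable fun n => |a n / lam n|) {N : ℕ} (hN : 1 ≤ N) :
    ∃ K : ℝ, ∀ t : ℝ, t₀ < t →
      |∑' n, a n * psi α t₀ μ (lam n) t -
        ∑ k ∈ Finset.range N, mlCoeff α k * (∑' n, a n * ((lam n)⁻¹) ^ (k + 1)) *
          powerConv t₀ μ (1 + α * k) t| ≤
        K * (t - t₀) ^ (-(α * N + 1 - α / 2)) := by
  obtain ⟨C, hC0, hC⟩ := exists_abs_psi_sub_le hα ht₀ hμ N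
  have hN' : (1 : ℝ) ≤ N := by exact_mod_cast hN
  -- `N ≥ 1` puts the exponent above `1`, where the hypothesis on `a n / lam n` gives summability.
  have hsum := summable_mul_rpow hpos hmono ha (e := N + 1 / 2) (by linarith)
  refine ⟨C * ∑' n, |a n| * lam n ^ (-(N + 1 / 2) : ℝ), fun t ht => ?_⟩
  set d := (t - t₀) ^ (-(α * N + 1 - α / 2)) with hd
  set S : ℕ → ℝ := fun n => ∑ k ∈ Finset.range N,
    mlCoeff α k * ((lam n)⁻¹) ^ (k + 1) * powerConv t₀ μ (1 + α * k) t with hS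
  have hSa (n : ℕ) : a n * S n = ∑ k ∈ Finset.range N,
      (a n * ((lam n)⁻¹) ^ (k + 1)) * (mlCoeff α k * powerConv t₀ μ (1 + α * k) t) := by
    rw [hS, Finset.mul_sum]
    exact Finset.sum_congr rfl fun k _ => by ring
  have hterm (k : ℕ) := (summable_mul_inv_pow hpos hmono ha k).hasSum.mul_right
    (mlCoeff α k * powerConv t₀ μ (1 + α * k) t)
  have hSsum : HasSum (fun n => a n * S n)
      (∑ k ∈ Finset.range N, (∑' n, a n * ((lam n)⁻¹) ^ (k + 1)) *
        (mlCoeff α k * powerConv t₀ μ (1 + α * k) t)) := by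
    simp_rw [hSa]
    exact hasSum_sum fun k _ => hterm k
  have hRle (n : ℕ) : ‖a n * (psi α t₀ μ (lam n) t - S n)‖ ≤
      C * d * (|a n| * lam n ^ (-(N + 1 / 2) : ℝ)) := by
    rw [norm_mul, Real.norm_eq_abs, Real.norm_eq_abs]
    calc _ ≤ |a n| * (C * lam n ^ (-(N + 1 / 2) : ℝ) * d) := by
          gcongr
          exact hC _ (hpos n) t ht
      _ = _ := by ring
  have hRsum : Summable fun n => a n * (psi α t₀ μ (lam n) t - S n) :=
    Summable.of_norm_bounded (hsum.mul_left _) hRle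
  -- Both parts are summable, so the superposition genuinely converges and its `tsum` is not the
  -- default value `0`.
  have htot : ∑' n, a n * psi α t₀ μ (lam n) t =
      (∑' n, a n * (psi α t₀ μ (lam n) t - S n)) + ∑' n, a n * S n := by
    rw [← hRsum.tsum_add hSsum.summable]
    exact tsum_congr fun n => by ring
  have hcomm : ∑ k ∈ Finset.range N, mlCoeff α k * (∑' n, a n * ((lam n)⁻¹) ^ (k + 1)) *
      powerConv t₀ μ (1 + α * k) t = ∑' n, a n * S n := by
    rw [hSsum.tsum_eq]
    exact Finset.sum_congr rfl fun k _ => by ring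
  rw [htot, hcomm, add_sub_cancel_right, ← Real.norm_eq_abs]
  refine (tsum_of_norm_bounded (hsum.hasSum.mul_left (C * d)) hRle).trans_eq (by ring)

theorem tendsto_rpow_mul_sub_rpow {e q : ℝ} (h : e < q) (t₀ : ℝ) :
    Tendsto (fun t : ℝ => t ^ e * (t - t₀) ^ (-q)) atTop (𝓝 0) := by
  have h1 : Tendsto (fun t : ℝ => t ^ (-(q - e))) atTop (𝓝 0) :=
    tendsto_rpow_neg_atTop (sub_pos.2 h)
  have h2 : Tendsto (fun t : ℝ => (1 - t₀ * t⁻¹) ^ (-q)) atTop (𝓝 1) := by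
    have h3 : Tendsto (fun t : ℝ => 1 - t₀ * t⁻¹) atTop (𝓝 1) := by
      simpa using (tendsto_inv_atTop_zero.const_mul t₀).const_sub (1 : ℝ)
    simpa using h3.rpow_const (p := -q) (Or.inl one_ne_zero)
  have h4 := h1.mul h2
  rw [zero_mul] at h4
  refine h4.congr' ?_
  filter_upwards [eventually_gt_atTop 0, eventually_gt_atTop t₀] with t ht ht'
  have e1 : t - t₀ = t * (1 - t₀ * t⁻¹) := by field_simp
  have e2 : 0 ≤ 1 - t₀ * t⁻¹ := by
    rw [← div_eq_mul_inv, sub_nonneg, div_le_one ht]; exact ht'.le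
  have e3 : -(q - e) = e + -q := by ring
  rw [e1, Real.mul_rpow ht.le e2, e3, Real.rpow_add ht]
  ring

/-- Rapid decay forces every term of the asymptotic expansion to vanish. -/
theorem mlCoeff_mul_tsum_eq_zero {α : ℝ} (hα : α ∈ Ioo (0 : ℝ) 2) {t₀ : ℝ} (ht₀ : 0 < t₀)
    {μ : ℝ → ℝ} (hμ : IntervalIntegrable μ volume 0 t₀)
    {m : ℕ} (hm : ∀ j < m, ∫ s in (0 : ℝ)..t₀, s ^ j * μ s = 0)
    (hm0 : ∫ s in (0 : ℝ)..t₀, s ^ m * μ s ≠ 0)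
    {lam a : ℕ → ℝ} (hpos : ∀ n, 0 < lam n) (hmono : StrictMono lam)
    (ha : Summable fun n => |a n / lam n|)
    (hdecay : ∀ e : ℝ, Tendsto (fun t : ℝ => t ^ e * ∑' n, a n * psi α t₀ μ (lam n) t)
      atTop (𝓝 0)) (k : ℕ) :
    mlCoeff α k * ∑' n, a n * ((lam n)⁻¹) ^ (k + 1) = 0 := by
  induction k using Nat.strong_induction_on with
  | _ k ih =>
  have hα0 := hα.1
  set d : ℕ → ℝ := fun k => mlCoeff α k * ∑' n, a n * ((lam n)⁻¹) ^ (k + 1) with hd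
  set e : ℝ := 1 + α * k + m with he
  -- `e` is the decay exponent of the `k`-th term; this `N` makes the remainder decay faster than `t
  -- ^ (-e)`.
  obtain ⟨N, hN⟩ := exists_nat_gt (k + (m + 1) / α : ℝ)
  have hm1 : 0 < ((m : ℝ) + 1) / α := by positivity
  have hkN : k < N := by
    have : (k : ℝ) < N := by linarith
    exact_mod_cast this
  have heq : e < α * N + 1 - α / 2 := by
    have h1 : α * (k + (m + 1) / α) < α * N := mul_lt_mul_of_pos_left hN hα0
    have h2 : α * (k + (m + 1) / α) = α * k + (m + 1) := by field_simp
    have := hα.2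
    rw [he]; linarith
  obtain ⟨K, hK⟩ := exists_abs_tsum_psi_sub_le hα ht₀ hμ hpos hmono ha
    (N := N) (by omega)
  have hdiff : Tendsto (fun t : ℝ => t ^ e * (∑' n, a n * psi α t₀ μ (lam n) t -
      ∑ i ∈ Finset.range N, d i * powerConv t₀ μ (1 + α * i) t)) atTop (𝓝 0) := by
    have hb := (tendsto_rpow_mul_sub_rpow heq t₀).const_mul K
    rw [mul_zero] at hb
    refine squeeze_zero_norm' ?_ hb
    filter_upwards [eventually_gt_atTop t₀] with t ht
    have hte : 0 < t ^ e := Real.rpow_pos_of_pos (ht₀.trans ht) _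
    rw [norm_mul, Real.norm_of_nonneg hte.le, Real.norm_eq_abs]
    calc _ ≤ t ^ e * (K * (t - t₀) ^ (-(α * N + 1 - α / 2))) := by
          gcongr
          exact hK t ht
      _ = _ := by ring
  have hsum0 : Tendsto (fun t : ℝ => ∑ i ∈ Finset.range N,
      t ^ e * (d i * powerConv t₀ μ (1 + α * i) t)) atTop (𝓝 0) := by
    have := (hdecay e).sub hdiff
    rw [sub_zero] at this
    refine this.congr fun t => ?_
    rw [← Finset.mul_sum]; ring
  set L : ℝ := Ring.choose (1 + α * k + m - 1) m * ∫ s in (0 : ℝ)..t₀, s ^ m * μ s with hL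
  -- At the scale `t ^ e` the terms `i < k` are zero by induction, those with `i > k` tend to zero,
  -- and only `i = k` has a possibly nonzero limit.
  have hsumL : Tendsto (fun t : ℝ => ∑ i ∈ Finset.range N,
      t ^ e * (d i * powerConv t₀ μ (1 + α * i) t)) atTop
      (𝓝 (∑ i ∈ Finset.range N, if i = k then d k * L else 0)) := by
    refine tendsto_finsetSum _ fun i _ => ?_
    have hi := tendsto_rpow_mul_powerConv ht₀ hμ (1 + α * i) hm
    rcases lt_trichotomy i k with h | h | h
    · have : d i = 0 := ih i h
      simp [this, h.ne]
    · subst h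
      simp only [if_true]
      refine (hi.const_mul (d i)).congr fun t => ?_
      rw [he]; ring
    · simp only [h.ne', if_false]
      have hik : (k : ℝ) < i := by exact_mod_cast h
      have hp : Tendsto (fun t : ℝ => t ^ (-(α * (i - k)))) atTop (𝓝 0) :=
        tendsto_rpow_neg_atTop (mul_pos hα0 (sub_pos.2 hik))
      have := (hp.mul hi).const_mul (d i)
      rw [zero_mul, mul_zero] at this
      refine this.congr' ?_
      filter_upwards [eventually_gt_atTop 0] with t ht
      have ee : e = -(α * (i - k)) + (1 + α * i + m) := by rw [he]; ring
      have hte : t ^ e = t ^ (-(α * (i - k))) * t ^ (1 + α * i + m) := by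
        rw [← Real.rpow_add ht, ← ee]
      rw [hte]
      ring
  rw [Finset.sum_ite_eq' , if_pos (Finset.mem_range.2 hkN)] at hsumL
  have h0 := tendsto_nhds_unique hsumL hsum0
  have hL0 : L ≠ 0 := mul_ne_zero (multichoose_pos (by positivity) m).ne' hm0
  exact (mul_eq_zero.1 h0).resolve_right hL0

theorem tendsto_rpow_mul_of_rapid_decay {f : ℝ → ℝ} {T₁ : ℝ}
    (hdecay : ∀ p : ℕ, 1 ≤ p → ∃ T₂ : ℝ, 0 < T₂ ∧ ∃ C : ℝ, 0 < C ∧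
      ∀ t : ℝ, T₁ ≤ t → T₂ < t → |f t| ≤ C / t ^ p) (e : ℝ) :
    Tendsto (fun t : ℝ => t ^ e * f t) atTop (𝓝 0) := by
  obtain ⟨p, hp⟩ := exists_nat_gt (max e 0)
  have hp0 : (0 : ℝ) < p := (le_max_right _ _).trans_lt hp
  obtain ⟨T₂, hT₂, C, hC, h⟩ := hdecay p (by exact_mod_cast hp0)
  have hb := (tendsto_rpow_neg_atTop (sub_pos.2 ((le_max_left _ _).trans_lt hp))).const_mul C
  rw [mul_zero] at hb
  refine squeeze_zero_norm' ?_ hb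
  filter_upwards [eventually_ge_atTop T₁, eventually_gt_atTop T₂] with t h1 h2
  have ht : 0 < t := hT₂.trans h2
  have hte := Real.rpow_pos_of_pos ht e
  rw [norm_mul, Real.norm_of_nonneg hte.le, Real.norm_eq_abs]
  calc t ^ e * |f t| ≤ t ^ e * (C / t ^ p) := by
        gcongr
        exact h t h1 h2
    _ = _ := by
        rw [neg_sub, Real.rpow_sub ht, Real.rpow_natCast]; ring

theorem proposition1 (α : ℝ) (hα : α ∈ Ioo (0 : ℝ) 1 ∪ Ioo (1 : ℝ) 2)
    (t₀ T₁ : ℝ) (ht₀ : 0 < t₀) (hT₁ : t₀ < T₁)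
    (μ : ℝ → ℝ) (hμ : MemLp μ 2 (volume.restrict (Ioo 0 t₀)))
    (hμ0 : ¬ (∀ᵐ s ∂(volume.restrict (Ioo 0 t₀)), μ s = 0))
    (lam : ℕ → ℝ) (hlam_pos : ∀ n, 0 < lam n) (hlam_mono : StrictMono lam)
    (a : ℕ → ℝ) (ha : Summable (fun n => |a n / lam n|))
    (hdecay : ∀ p : ℕ, 1 ≤ p → ∃ T₂ : ℝ, 0 < T₂ ∧ ∃ C : ℝ, 0 < C ∧
      ∀ t : ℝ, T₁ ≤ t → T₂ < t → |∑' n, a n * psi α t₀ μ (lam n) t| ≤ C / t ^ p) :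
    ∀ n, a n = 0 := by
  have hα2 : α ∈ Ioo (0 : ℝ) 2 := by
    rcases hα with h | h
    · exact ⟨h.1, by linarith [h.2]⟩
    · exact ⟨by linarith [h.1], h.2⟩
  have hμi : IntervalIntegrable μ volume 0 t₀ := by
    rw [intervalIntegrable_iff_integrableOn_Ioo_of_le ht₀.le]
    exact hμ.integrable (by norm_num)
  -- A nonzero moment exists because `μ` would otherwise vanish almost everywhere; the least such
  -- index is the `m` of the expansion.
  have hex : ∃ j : ℕ, ∫ s in (0 : ℝ)..t₀, s ^ j * μ s ≠ 0 := by
    by_contra! h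
    exact hμ0 (ae_eq_zero_of_moments_eq_zero ht₀ hμi h)
  classical
  have hzero := mlCoeff_mul_tsum_eq_zero hα2 ht₀ hμi (m := Nat.find hex)
    (fun j hj => not_not.1 (Nat.find_min hex hj)) (Nat.find_spec hex) hlam_pos hlam_mono ha
    (tendsto_rpow_mul_of_rapid_decay hdecay)
  exact eq_zero_of_frequently_tsum_eq_zero hlam_pos hlam_mono ha
    ((frequently_mlCoeff_ne_zero hα).mono fun k hk => (mul_eq_zero.1 (hzero k)).resolve_left hk)
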